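/- **Setting.** Let $1\le d\le 3$, $k\ge 0$ and $\sigma>0$. Let $\Omega\subset\mathbb R^d$ be a polygonal (polyhedral) domain with boundary $\Gamma$, and let $\mathcal T$ be a conforming triangulation of $\Omega$ into simplices $K$ with diameters $h_K$, unit outward normals $n$ on $\partial K$, and shape-regularity parameter $\sigma$ (each $K$ contains a ball of radius $h_K/\sigma$). Let $\Gamma^0$ be the union of all facets, let $\kappa>0$, $\alpha>0$, $0\le l\le 1$, and let $$W_h=\{w\in L^2(\Omega): w|_K\in P_k(K)\ \forall K\},\qquad \bar W_h=\{\bar w\in H^l(\Gamma^0): \bar w|_F\in P_k(F)\ \forall F,\ \bar w=0 \text{ on }\Gamma\},$$ $W_h^\star=W_h\times\bar W_h$, and $W^\star(h)=\bigl(W_h+H^2(\Omega)\cap H^1_0(\Omega)\bigr)\times\bigl(\bar W_h+\gamma(H^2(\Omega)\cap H^1_0(\Omega))\bigr)$, where $\gamma$ is the trace on $\Gamma^0$. For $\boldsymbol w=(w,\bar w)$, $\boldsymbol v=(v,\bar v)$ in $W^\star(h)$ put $$B_D(\boldsymbol w,\boldsymbol v)=\sum_K\int_K\kappa\nabla w\cdot\nabla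 v\,dx+\sum_K\int_{\partial K}\Bigl(\kappa\nabla w\cdot n+\tfrac{\alpha\kappa}{h_K}(\bar w-w)\Bigr)(\bar v-v)\,ds+\sum_K\int_{\partial K}\kappa(\bar w-w)\nabla v\cdot n\,ds,$$ $$|||\boldsymbol v|||_D^2=\sum_K\kappa\|\nabla v\|_{0,K}^2+\sum_K\tfrac{\alpha\kappa}{h_K}\|\bar v-v\|_{0,\partial K}^2,\qquad |||\boldsymbol v|||_{D'}^2=|||\boldsymbol v|||_D^2+\sum_K\tfrac{h_K^2\kappa}{\alpha}|v|_{2,K}^2,$$ where $|v|_{2,K}^2=\sum_{i,j}\|\partial_i\partial_j v\|_{0,K}^2$. **Claim.** There are a constant $c>0$, constants $C_D=C_D(\alpha)>0$ for $\alpha>0$, a threshold $\alpha_0>0$, and constants $\beta(\alpha)>0$ for $\alpha>\alpha_0$, all depending only on $d,k,\sigma$ (and, where indicated, on $\alpha$), but not on $\Omega$, the mesh, $h$, $l$ or $\kappa$, such that in every such setting: 1. $|||\boldsymbol v_h|||_{D'}\le(1+c\alpha^{-1})\,|||\boldsymbol v_h|||_D$ for all $\boldsymbol v_h\in W_h^\star$;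 2. $|B_D(\boldsymbol w,\boldsymbol v)|\le C_D\,|||\boldsymbol w|||_{D'}\,|||\boldsymbol v|||_{D'}$ for all $\boldsymbol w,\boldsymbol v\in W^\star(h)$; 3. if $\alpha>\alpha_0$, then $B_D$ is coercive on $W_h^\star$ with constant $\beta(\alpha)$: $B_D(\boldsymbol v_h,\boldsymbol v_h)\ge\beta(\alpha)\,|||\boldsymbol v_h|||_D^2$ for all $\boldsymbol v_h\in W_h^\star$; 4. (convergence) whenever $B_D$ is coercive on $W_h^\star$ with a constant $\beta_D>0$ (in particular for $\alpha>\alpha_0$ with $\beta_D=\beta(\alpha)$), if $u\in H^2(\Omega)\cap H^1_0(\Omega)$ solves $-\kappa\nabla^2u=f$ in $\Omega$, $\boldsymbol u=(u,\gamma u)$, and $\boldsymbol u_h\in W_h^\star$ satisfies $B_D(\boldsymbol u_h,\boldsymbol v_h)=\int_\Omega f v_h\,dx$ for all $\boldsymbol v_h=(v_h,\bar v_h)\in W_h^\star$, then $$|||\boldsymbol u-\boldsymbol u_h|||_D\le\Bigl(1+\frac{(1+c\alpha^{-1})C_D}{\beta_D}\Bigr)\inf_{\boldsymbol w_h\in W_h^\star}|||\boldsymbol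 u-\boldsymbol w_h|||_{D'}.$$ -/

import Mathlib

open MeasureTheory Filter Topology Set
open scoped ENNReal ContDiff

noncomputable section

namespace ISM

/-- Euclidean space `ℝ^d`. -/
abbrev E (d : ℕ) : Type := EuclideanSpace ℝ (Fin d)

/-! ### Domain, triangulation, facets, normals -/

/-- The standing conditions on the domain: a nonempty connected open set which does not lie on both
sides of its boundary. That it is bounded and polygonal (polyhedral) is a consequence of the
existence of a triangulation, see `Triangulation`. -/
structure IsDomain {d : ℕ} (Ω : Set (E d)) : Prop where
  isOpen : IsOpen Ω
  isConnected : IsConnected Ω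
  interior_closure : interior (closure Ω) = Ω

/-- A (conforming) triangulation of `Ω`: a finite simplicial complex all of whose maximal simplices
are `d`-dimensional and which covers `closure Ω`. -/
structure Triangulation {d : ℕ} (Ω : Set (E d)) where
  complex : Geometry.SimplicialComplex ℝ (E d)
  finite : complex.faces.Finite
  pure : ∀ s ∈ complex.faces, ∃ t ∈ complex.faces, s ⊆ t ∧ t.card = d + 1
  space_eq : complex.space = closure Ω

/-- The closed simplex with a given vertex set. -/
def hull {d : ℕ} (s : Finset (E d)) : Set (E d) := convexHull ℝ (s : Set (E d))

/-- The size `h_K` of a cell: its diameter. -/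
def size {d : ℕ} (K : Finset (E d)) : ℝ := Metric.diam (hull K)

/-- Surface measure (`(d-1)`-dimensional Hausdorff measure, normalised to agree with Lebesgue
measure on hyperplanes; counting measure if `d = 1`) on the facet with vertex set `F`. -/
def surf {d : ℕ} (F : Finset (E d)) : Measure (E d) :=
  (Measure.euclideanHausdorffMeasure (d - 1)).restrict (hull F)

/-- `n` is a unit vector, orthogonal to the facet `F` of `K`, and pointing out of `K`. -/
def IsOutwardNormal {d : ℕ} (K F : Finset (E d)) (n : E d) : Prop :=
  ‖n‖ = 1 ∧ (∀ x ∈ F, ∀ y ∈ F, inner ℝ n (x - y) = 0) ∧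
    ∀ x ∈ F, ∀ q ∈ K, q ∉ F → inner ℝ n (q - x) < 0

/-- The outward unit normal of the cell `K` on its facet `F`. -/
def normal {d : ℕ} (K F : Finset (E d)) : E d := Classical.epsilon (IsOutwardNormal K F)

/-- The defining property of the outward normal holds on every facet of every simplex. -/
theorem normal_spec {d : ℕ} {K F : Finset (E d)}
    (hK : AffineIndependent ℝ ((↑) : K → E d)) (hFK : F ⊆ K) (hF : F.Nonempty)
    (hc : K.card = F.card + 1) : IsOutwardNormal K F (normal K F) := by
  apply Classical.epsilon_spec (p := IsOutwardNormal K F)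
  classical
  obtain ⟨x₀, hx₀⟩ := hF
  obtain ⟨q, hq⟩ : ∃ q, K \ F = {q} := by
    rw [← Finset.card_eq_one, Finset.card_sdiff_of_subset hFK]
    omega
  have hqK : q ∈ K ∧ q ∉ F := by
    have : q ∈ K \ F := by rw [hq]; simp
    simpa using this
  let W : Submodule ℝ (E d) := vectorSpan ℝ (F : Set (E d))
  let u : E d := (x₀ - q) - W.starProjection (x₀ - q)
  have hu : u ∈ Wᗮ := Submodule.sub_starProjection_mem_orthogonal (K := W) (x₀ - q)
  have hW : ∀ x ∈ F, ∀ y ∈ F, x - y ∈ W := fun x hx y hy =>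
    vsub_mem_vectorSpan ℝ (Finset.mem_coe.2 hx) (Finset.mem_coe.2 hy)
  have hnot : x₀ - q ∉ W := by
    intro h
    have h1 : q ∈ affineSpan ℝ (F : Set (E d)) := by
      have h2 : -(x₀ - q) ∈ (affineSpan ℝ (F : Set (E d))).direction := by
        rw [direction_affineSpan]; exact W.neg_mem h
      have h3 := AffineSubspace.vadd_mem_of_mem_direction h2
        (mem_affineSpan ℝ (Finset.mem_coe.2 hx₀))
      simpa using h3
    have h4 := hK.notMem_affineSpan_sdiff (⟨q, hqK.1⟩ : K) (Subtype.val ⁻¹' (F : Set (E d)))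
    apply h4
    have h5 : ((↑) : K → E d) '' ((Subtype.val ⁻¹' (F : Set (E d))) \ {⟨q, hqK.1⟩})
        = (F : Set (E d)) := by
      ext y
      constructor
      · rintro ⟨z, ⟨hz, -⟩, rfl⟩
        exact hz
      · intro hy
        refine ⟨⟨y, hFK hy⟩, ⟨hy, ?_⟩, rfl⟩
        intro h
        apply hqK.2
        have := congrArg Subtype.val (Set.mem_singleton_iff.1 h)
        simp only at this
        rw [← this]
        exact hy
    rw [h5]
    exact h1
  have hu0 : u ≠ 0 := by
    intro h
    apply hnot
    rw [sub_eq_zero.1 h]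
    exact Submodule.starProjection_apply_mem _ _
  have hun : 0 < ‖u‖ := norm_pos_iff.2 hu0
  have huu : inner ℝ u (x₀ - q) = ‖u‖ ^ 2 := by
    have h1 : x₀ - q = u + W.starProjection (x₀ - q) := by simp [u]
    rw [h1, inner_add_right, real_inner_self_eq_norm_sq,
      Submodule.inner_left_of_mem_orthogonal (Submodule.starProjection_apply_mem _ _) hu, add_zero]
  refine ⟨‖u‖⁻¹ • u, ?_, ?_, ?_⟩
  · rw [norm_smul, norm_inv, norm_norm, inv_mul_cancel₀ hun.ne']
  · intro x hx y hy
    rw [real_inner_smul_left, Submodule.inner_left_of_mem_orthogonal (hW x hx y hy) hu, mul_zero]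
  · intro x hx p hpK hpF
    have hp : p = q := by
      have : p ∈ K \ F := by simp [hpK, hpF]
      rw [hq] at this
      simpa using this
    subst hp
    have h1 : p - x = -(x₀ - p) + (x₀ - x) := by abel
    rw [real_inner_smul_left, h1, inner_add_right, inner_neg_right, huu,
      Submodule.inner_left_of_mem_orthogonal (hW x₀ hx₀ x hx) hu, add_zero]
    have : 0 < ‖u‖⁻¹ * ‖u‖ ^ 2 := by positivity
    linarith

/-! ### Sobolev functions -/

/-- The classical partial derivative `∂_i φ`. -/
def pd {d : ℕ} (i : Fin d) (φ : E d → ℝ) (x : E d) : ℝ :=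
  fderiv ℝ φ x (EuclideanSpace.single i 1)

/-- `g` is the weak partial derivative `∂_i v` on the open set `Ω`. -/
def HasWeakPartial {d : ℕ} (Ω : Set (E d)) (i : Fin d) (v g : E d → ℝ) : Prop :=
  ∀ φ : E d → ℝ, ContDiff ℝ ∞ φ → HasCompactSupport φ → tsupport φ ⊆ Ω →
    ∫ x in Ω, v x * pd i φ x = - ∫ x in Ω, g x * φ x

/-- `v`, with weak gradient `G`, lies in `H¹₀(Ω)`: it is a limit in `H¹(Ω)` of smooth functions with
compact support in `Ω`. -/
def MemH10 {d : ℕ} (Ω : Set (E d)) (v : E d → ℝ) (G : Fin d → E d → ℝ) : Prop :=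
  ∃ φ : ℕ → E d → ℝ,
    (∀ n, ContDiff ℝ ∞ (φ n) ∧ HasCompactSupport (φ n) ∧ tsupport (φ n) ⊆ Ω) ∧
    Tendsto (fun n => eLpNorm (fun x => φ n x - v x) 2 (volume.restrict Ω)) atTop (𝓝 0) ∧
    ∀ i, Tendsto (fun n => eLpNorm (fun x => pd i (φ n) x - G i x) 2 (volume.restrict Ω))
      atTop (𝓝 0)

namespace Triangulation

variable {d : ℕ} {Ω : Set (E d)} (T : Triangulation Ω)

/-- The cells: the `d`-simplices of the triangulation, given by their vertex sets. -/
def cells : Finset (Finset (E d)) := T.finite.toFinset.filter (fun s => s.card = d + 1)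

/-- The facets: the `(d-1)`-simplices of the triangulation, given by their vertex sets. -/
def facets : Finset (Finset (E d)) := T.finite.toFinset.filter (fun s => s.card = d)

/-- The type of cells. -/
abbrev Cell : Type := {K : Finset (E d) // K ∈ T.cells}

/-- The type of facets. -/
abbrev Facet : Type := {F : Finset (E d) // F ∈ T.facets}

open Classical in
/-- The facets of the cell `K`; the boundary of `K` is their union. -/
def facetsOf (K : T.Cell) : Finset T.Facet := Finset.univ.filter (fun F => F.1 ⊆ K.1)

/-- Shape regularity with parameter `σ`: every cell `K` contains a ball of radius `h_K / σ`. -/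
def ShapeRegular (σ : ℝ) : Prop :=
  ∀ K ∈ T.cells, ∃ x, Metric.closedBall x (size K / σ) ⊆ hull K

/-- `g` is the trace on `∂K` of the function `v ∈ H¹(K)` with weak gradient `G`: there are smooth
functions which converge to `v` in `H¹(K)` and whose restrictions to `∂K` converge to `g` in
`L²(∂K)`. -/
def IsCellTrace (K : T.Cell) (v : E d → ℝ) (G : Fin d → E d → ℝ) (g : E d → ℝ) : Prop :=
  (∀ F ∈ T.facetsOf K, MemLp g 2 (surf F.1)) ∧
  ∃ φ : ℕ → E d → ℝ,
    (∀ n, ContDiff ℝ ∞ (φ n)) ∧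
    Tendsto (fun n => eLpNorm (fun x => φ n x - v x) 2 (volume.restrict (hull K.1)))
      atTop (𝓝 0) ∧
    (∀ i, Tendsto (fun n => eLpNorm (fun x => pd i (φ n) x - G i x) 2
      (volume.restrict (hull K.1))) atTop (𝓝 0)) ∧
    ∀ F ∈ T.facetsOf K, Tendsto (fun n => eLpNorm (fun x => φ n x - g x) 2 (surf F.1)) atTop (𝓝 0)

/-- `g` is the trace on the union of all facets of the function `v ∈ H¹(Ω)` with weak gradient
`G`. -/
def IsTrace (v : E d → ℝ) (G : Fin d → E d → ℝ) (g : E d → ℝ) : Prop :=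
  ∀ K : T.Cell, T.IsCellTrace K v G g

/-- A function in `H²(Ω) ∩ H¹₀(Ω)`, listed together with its weak derivatives of first and second
order and with the traces, on the union of all facets, of the function and of its first
derivatives. All these are determined almost everywhere by the function. -/
structure H2H10 where
  val : E d → ℝ
  grad : Fin d → E d → ℝ
  hess : Fin d → Fin d → E d → ℝ
  trace : E d → ℝ
  gradTrace : Fin d → E d → ℝ
  val_memLp : MemLp val 2 (volume.restrict Ω)
  grad_memLp : ∀ i, MemLp (grad i) 2 (volume.restrict Ω)
  hess_memLp : ∀ i j, MemLp (hess i j) 2 (volume.restrict Ω)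
  weak_grad : ∀ i, HasWeakPartial Ω i val (grad i)
  weak_hess : ∀ i j, HasWeakPartial Ω j (grad i) (hess i j)
  memH10 : MemH10 Ω val grad
  isTrace : T.IsTrace val grad trace
  isTrace_grad : ∀ i, T.IsTrace (grad i) (hess i) (gradTrace i)

/-! ### Pairs (cell function, facet function) -/

/-- Data of a pair `(v, v̄)`, where `v` is a cellwise `H²` function and `v̄` a function on facets:
for every cell `K`, the function `v|_K`, its first and second derivatives, and the traces on `∂K`
of `v|_K` and `∇v|_K`; for every facet `F`, the function `v̄|_F`. Only the pairs in `Wh` and `Wext`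
below are used. -/
structure Pair where
  val : T.Cell → E d → ℝ
  grad : T.Cell → Fin d → E d → ℝ
  hess : T.Cell → Fin d → Fin d → E d → ℝ
  tr : T.Cell → E d → ℝ
  gradTr : T.Cell → Fin d → E d → ℝ
  bar : T.Facet → E d → ℝ

instance : Add T.Pair where
  add v w :=
    { val := fun K x => v.val K x + w.val K x
      grad := fun K i x => v.grad K i x + w.grad K i x
      hess := fun K i j x => v.hess K i j x + w.hess K i j x
      tr := fun K x => v.tr K x + w.tr K x
      gradTr := fun K i x => v.gradTr K i x + w.gradTr K i x
      bar := fun F x => v.bar F x + w.bar F x }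

instance : Sub T.Pair where
  sub v w :=
    { val := fun K x => v.val K x - w.val K x
      grad := fun K i x => v.grad K i x - w.grad K i x
      hess := fun K i j x => v.hess K i j x - w.hess K i j x
      tr := fun K x => v.tr K x - w.tr K x
      gradTr := fun K i x => v.gradTr K i x - w.gradTr K i x
      bar := fun F x => v.bar F x - w.bar F x }

/-- The value of a polynomial at a point of `ℝ^d`. -/
def ev {d : ℕ} (p : MvPolynomial (Fin d) ℝ) (x : E d) : ℝ := MvPolynomial.eval (fun i => x i) p

/-- The pair given by a polynomial `p K` on every cell `K` and (the restriction to `F` of) a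
polynomial `q F` on every facet `F`. -/
def polyPair (p : T.Cell → MvPolynomial (Fin d) ℝ) (q : T.Facet → MvPolynomial (Fin d) ℝ) :
    T.Pair where
  val K := ev (p K)
  grad K i := ev (MvPolynomial.pderiv i (p K))
  hess K i j := ev (MvPolynomial.pderiv j (MvPolynomial.pderiv i (p K)))
  tr K := ev (p K)
  gradTr K i := ev (MvPolynomial.pderiv i (p K))
  bar F := ev (q F)

/-- The pair `(z, γ z')`, where `γ` is the trace on the union of all facets. -/
def sobolevPair (z z' : T.H2H10) : T.Pair where
  val _ := z.val
  grad _ := z.grad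
  hess _ := z.hess
  tr _ := z.trace
  gradTr _ := z.gradTrace
  bar _ := z'.trace

/-- Membership of the facet function `g` in `H^l(Γ⁰)`, `0 ≤ l ≤ 1`, where `Γ⁰` is the union of all
facets: `L²(Γ⁰)` for `l = 0`; finite Sobolev-Slobodeckij double integral for `0 < l < 1`; for
`l = 1` the closure of the restrictions of smooth functions in the norm given by the `L²(Γ⁰)`
norms of the function and of its tangential gradient. -/
def MemHFacets (l : ℝ) (g : T.Facet → E d → ℝ) : Prop :=
  (∀ F, MemLp (g F) 2 (surf F.1)) ∧
  (0 < l → l < 1 → ∀ F F' : T.Facet,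
    ∫⁻ x, ∫⁻ y, ENNReal.ofReal ((g F x - g F' y) ^ 2 / dist x y ^ (2 * l + ((d : ℝ) - 1)))
      ∂(surf F'.1) ∂(surf F.1) < ⊤) ∧
  (l = 1 → ∃ (φ : ℕ → E d → ℝ) (τ : T.Facet → E d → E d),
    (∀ n, ContDiff ℝ ∞ (φ n)) ∧ (∀ F, MemLp (τ F) 2 (surf F.1)) ∧
    ∀ F : T.Facet,
      Tendsto (fun n => eLpNorm (fun x => φ n x - g F x) 2 (surf F.1)) atTop (𝓝 0) ∧
      Tendsto (fun n => eLpNorm (fun x =>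
        (vectorSpan ℝ (F.1 : Set (E d))).starProjection (gradient (φ n) x) - τ F x) 2 (surf F.1))
        atTop (𝓝 0))

/-- The finite element space `W_h × W̄_h` of order `k`, with facet functions in `H^l(Γ⁰)` which
vanish on the boundary of the domain. -/
def Wh (k : ℕ) (l : ℝ) : Set T.Pair :=
  {v | ∃ (p : T.Cell → MvPolynomial (Fin d) ℝ) (q : T.Facet → MvPolynomial (Fin d) ℝ),
    (∀ K, (p K).totalDegree ≤ k) ∧ (∀ F, (q F).totalDegree ≤ k) ∧
    T.MemHFacets l (fun F => ev (q F)) ∧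
    (∀ F : T.Facet, hull F.1 ⊆ frontier Ω → ∀ x ∈ hull F.1, ev (q F) x = 0) ∧
    v = T.polyPair p q}

/-- The extended space `W(h) × W̄(h)`, where `W(h) = W_h + H²(Ω) ∩ H¹₀(Ω)` and `W̄(h)` is the sum of
`W̄_h` and the space of traces of `H²(Ω) ∩ H¹₀(Ω)`. -/
def Wext (k : ℕ) (l : ℝ) : Set T.Pair :=
  {w | ∃ v ∈ T.Wh k l, ∃ z z' : T.H2H10, w = v + T.sobolevPair z z'}

/-! ### The method in the diffusive limit -/

variable {T}

/-- `v̄ - v` on the facet `F` of the cell `K`. -/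
def Pair.jump (v : T.Pair) (K : T.Cell) (F : T.Facet) (x : E d) : ℝ := v.bar F x - v.tr K x

/-- `∇v · n` on the facet `F` of the cell `K`. -/
def Pair.dn (v : T.Pair) (K : T.Cell) (F : T.Facet) (x : E d) : ℝ :=
  ∑ i, v.gradTr K i x * normal K.1 F.1 i

variable (T)

/-- The bilinear form `B_D`. -/
def BD (κ α : ℝ) (w v : T.Pair) : ℝ :=
  (∑ K : T.Cell, ∫ x in hull K.1, κ * ∑ i, w.grad K i x * v.grad K i x) +
  (∑ K : T.Cell, ∑ F ∈ T.facetsOf K,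
    ∫ x, (κ * w.dn K F x + α * κ / size K.1 * w.jump K F x) * v.jump K F x ∂(surf F.1)) +
  ∑ K : T.Cell, ∑ F ∈ T.facetsOf K, ∫ x, κ * w.jump K F x * v.dn K F x ∂(surf F.1)

/-- The linear form `L(v) = ∫_Ω f v`. -/
def L (f : E d → ℝ) (v : T.Pair) : ℝ := ∑ K : T.Cell, ∫ x in hull K.1, f x * v.val K x

/-- The stability norm `|||·|||_D`. -/
def normD (κ α : ℝ) (v : T.Pair) : ℝ :=
  √((∑ K : T.Cell, κ * ∫ x in hull K.1, ∑ i, v.grad K i x ^ 2) +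
    ∑ K : T.Cell, α * κ / size K.1 * ∑ F ∈ T.facetsOf K, ∫ x, v.jump K F x ^ 2 ∂(surf F.1))

/-- The continuity norm `|||·|||_{D'}`. -/
def normD' (κ α : ℝ) (v : T.Pair) : ℝ :=
  √(T.normD κ α v ^ 2 +
    ∑ K : T.Cell, size K.1 ^ 2 * κ / α * ∫ x in hull K.1, ∑ i, ∑ j, v.hess K i j x ^ 2)

/-- `u ∈ H²(Ω) ∩ H¹₀(Ω)` solves `-κ ∇²u = f` in `Ω`, `u = 0` on the boundary. -/
def Solves (κ : ℝ) (f : E d → ℝ) (u : T.H2H10) : Prop :=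
  ∀ᵐ x ∂(volume.restrict Ω), - κ * ∑ i, u.hess i i x = f x

/-- `uh` solves the finite element problem. -/
def SolvesFE (k : ℕ) (l κ α : ℝ) (f : E d → ℝ) (uh : T.Pair) : Prop :=
  uh ∈ T.Wh k l ∧ ∀ v ∈ T.Wh k l, T.BD κ α uh v = T.L f v

/-- Coercivity of `B_D` on the finite element space with constant `β`. -/
def Coercive (k : ℕ) (l κ α β : ℝ) : Prop :=
  ∀ v ∈ T.Wh k l, β * T.normD κ α v ^ 2 ≤ T.BD κ α v v

end Triangulation

end ISM

end

noncomputable section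

namespace ISM

/-! Everything rests on two local inequalities whose constants depend only on `d`, `k` and `σ`.
Applied to first derivatives, the trace inequality gives h‖∇v·n‖²_∂K ≤ σ(2d‖∇v‖²_K + h²|v|²_{2,K})
(`dnSq_le`); this is why the primed norm carries second derivatives. The inverse inequality
h²|v|²_{2,K} ≤ c‖∇v‖²_K (`exists_hessSq_le`) removes them again for polynomials. Continuity
(`abs_BD_le`) is Cauchy-Schwarz combined with the trace inequality. For coercivity
(`half_normD_sq_le_BD`), the cross term 2κ∫(∇v·n)(v̄ - v) is absorbed by Young's inequality once α >
4σ(2d + c).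

The trace inequality is the divergence theorem for the field φ²(x - x₀), with x₀ the centre of a
ball of radius h/σ inside K: on each facet (x - x₀)·n ≥ h/σ. The inverse inequality needs no
reference simplex. A cell lies between balls of radii h/σ and h about x₀, so after scaling it
compares two quadratic forms on a finite-dimensional space of polynomials. The divergence theorem on
a simplex comes from cones: for a vertex q, the field ψ(x - q) has flux only through the facet
opposite q. The difference of two such fields is ψ times an edge vector, and edge vectors span.

For consistency (`BD_sobolevPair_eq`), Green's formula on each cell leaves only the terms κ(∇u·n)v̄.
Their traces are single-valued, v̄ vanishes on the boundary, and an interior facet belongs to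
exactly two cells, with opposite normals, so the sum is zero (`sum_normal_mul_eq_zero`). Céa's
argument (`normD_error_le`) then gives the error estimate. Sobolev functions enter only as limits of
smooth functions: each formula is proved for smooth functions and passed to the limit in L². -/

/-! ### Integration over cones in coordinates adapted to a facet. -/

/-- Orthonormal coordinates adapted to a unit vector. -/
theorem exists_hyperplane_coordinates {m : ℕ} {n : E (m + 1)} (hn : ‖n‖ = 1) :
    ∃ L : E m →ₗᵢ[ℝ] E (m + 1), (∀ y, inner ℝ n (L y) = 0) ∧
      (∀ w, inner ℝ n w = 0 → ∃ y, L y = w) ∧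
      MeasurePreserving (fun p : ℝ × E m => p.1 • n + L p.2) volume volume := by
  have : Fact (Module.finrank ℝ (E (m + 1)) = m + 1) := ⟨by simp⟩
  have hn0 : n ≠ 0 := by
    rintro rfl
    simp at hn
  let b := OrthonormalBasis.fromOrthogonalSpanSingleton (𝕜 := ℝ) m hn0
  let L : E m →ₗᵢ[ℝ] E (m + 1) := (Submodule.subtypeₗᵢ _).comp b.repr.symm.toLinearIsometry
  have hL : ∀ y, inner ℝ n (L y) = 0 := fun y =>
    Submodule.mem_orthogonal_singleton_iff_inner_right.1 (b.repr.symm y).2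
  have hsurj : ∀ w, inner ℝ n w = 0 → ∃ y, L y = w := by
    intro w hw
    refine ⟨b.repr ⟨w, Submodule.mem_orthogonal_singleton_iff_inner_right.2 hw⟩, ?_⟩
    simp [L]
  refine ⟨L, hL, hsurj, ?_⟩
  -- With the Euclidean norm on the product, Φ is a linear isometry between spaces of equal
  -- dimension, hence preserves volume; passing from the plain product to `WithLp 2` preserves
  -- volume too.
  let Φ : WithLp 2 (ℝ × E m) →ₗ[ℝ] E (m + 1) :=
    { toFun := fun p => p.fst • n + L p.snd
      map_add' := fun p r => by simp [add_smul]; abel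
      map_smul' := fun c p => by simp [mul_smul] }
  have hΦ : ∀ p, ‖Φ p‖ = ‖p‖ := by
    intro p
    have h1 : ‖Φ p‖ ^ 2 = ‖p‖ ^ 2 := by
      rw [WithLp.prod_norm_sq_eq_of_L2]
      change ‖p.fst • n + L p.snd‖ ^ 2 = _
      rw [@norm_add_sq_real, real_inner_smul_left, hL, norm_smul, hn, L.norm_map]
      simp
    exact (sq_eq_sq₀ (norm_nonneg _) (norm_nonneg _)).1 h1
  let Φi : WithLp 2 (ℝ × E m) →ₗᵢ[ℝ] E (m + 1) := ⟨Φ, hΦ⟩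
  have hfr : Module.finrank ℝ (WithLp 2 (ℝ × E m)) = Module.finrank ℝ (E (m + 1)) := by
    rw [(WithLp.linearEquiv 2 ℝ (ℝ × E m)).finrank_eq]
    simp [Module.finrank_prod, add_comm]
  have h1 := (Φi.toLinearIsometryEquiv hfr).measurePreserving
  exact h1.comp (WithLp.volume_preserving_toLp ℝ (E m))

/-- Integration over a cone in adapted coordinates. -/
theorem setIntegral_cone {m : ℕ} {n q : E (m + 1)} {L : E m →ₗᵢ[ℝ] E (m + 1)}
    (hn : ‖n‖ = 1) (hL : ∀ y, inner ℝ n (L y) = 0)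
    (hmp : MeasurePreserving (fun p : ℝ × E m => p.1 • n + L p.2) volume volume)
    {K : Set (E (m + 1))} {A : Set (E m)} {H : ℝ} (hH : 0 < H)
    (hK : IsCompact K) (hA : IsCompact A)
    (hneg : ∀ s < (0 : ℝ), ∀ y, q + (s • n + L y) ∉ K)
    (hpos : ∀ t > (0 : ℝ), ∀ y, q + t • (H • n + L y) ∈ K ↔ t ≤ 1 ∧ y ∈ A)
    {g : E (m + 1) → ℝ} (hg : Continuous g) :
    ∫ x in K, g x = H * ∫ t in Ioc (0 : ℝ) 1, ∫ y in A, t ^ m * g (q + t • (H • n + L y)) := by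
  have hcont : Continuous (fun p : ℝ × E m => p.1 • n + L p.2) := by fun_prop
  have hinj : Function.Injective (fun p : ℝ × E m => p.1 • n + L p.2) := by
    rintro ⟨s, y⟩ ⟨s', y'⟩ h
    have h' : s • n + L y = s' • n + L y' := h
    have hs : s = s' := by
      have := congrArg (fun w => inner ℝ n w) h'
      simpa [inner_add_right, real_inner_smul_right, hL, hn] using this
    subst hs
    have := L.injective (add_left_cancel h')
    rw [this]
  have hmeas : MeasurableEmbedding (fun p : ℝ × E m => p.1 • n + L p.2) :=
    hcont.measurableEmbedding hinj
  have hmq : MeasurePreserving (fun x : E (m + 1) => q + x) volume volume :=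
    measurePreserving_add_left volume q
  have hmeq : MeasurableEmbedding (fun x : E (m + 1) => q + x) := measurableEmbedding_addLeft q
  set f : E (m + 1) → ℝ := K.indicator g with hf
  have hfint : Integrable f := (hg.continuousOn.integrableOn_compact hK).integrable_indicator
    hK.measurableSet
  have hfint2 : Integrable (fun p : ℝ × E m => f (q + (p.1 • n + L p.2))) := by
    have h1 := (hmq.comp hmp).integrable_comp_emb (hmeq.comp hmeas) (g := f)
    exact h1.2 hfint
  have e1 : ∫ x in K, g x = ∫ p : ℝ × E m, f (q + (p.1 • n + L p.2)) := by
    rw [← integral_indicator hK.measurableSet]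
    exact ((hmq.comp hmp).integral_comp (hmeq.comp hmeas) f).symm
  have e2 : ∫ p : ℝ × E m, f (q + (p.1 • n + L p.2))
      = ∫ s : ℝ, ∫ y : E m, f (q + (s • n + L y)) := by
    exact integral_prod _ hfint2
  have e3 : ∫ s : ℝ, ∫ y : E m, f (q + (s • n + L y))
      = ∫ s in Ioi (0 : ℝ), ∫ y : E m, f (q + (s • n + L y)) := by
    rw [← setIntegral_univ, ← integral_Ici_eq_integral_Ioi]
    apply setIntegral_eq_of_subset_of_forall_sdiff_eq_zero MeasurableSet.univ (subset_univ _)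
    intro s hs
    have hs' : s < 0 := by simpa using hs.2
    have : ∀ y, f (q + (s • n + L y)) = 0 := fun y => indicator_of_notMem (hneg s hs' y) _
    simp [this]
  -- The substitution s = Ht puts the apex at t = 0 and the base at t = 1.
  have e4 : ∫ s in Ioi (0 : ℝ), ∫ y : E m, f (q + (s • n + L y))
      = H * ∫ t in Ioi (0 : ℝ), ∫ y : E m, f (q + ((H * t) • n + L y)) := by
    have := integral_comp_mul_left_Ioi (fun s : ℝ => ∫ y : E m, f (q + (s • n + L y))) 0 hH
    simp only [mul_zero, smul_eq_mul] at this
    rw [this, ← mul_assoc, mul_inv_cancel₀ hH.ne', one_mul]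
  -- The slice at height Ht is the base scaled by t; substituting ty for y produces the Jacobian
  -- t^m.
  have e5 : ∀ t ∈ Ioi (0 : ℝ), ∫ y : E m, f (q + ((H * t) • n + L y))
      = (Ioc (0 : ℝ) 1).indicator
        (fun t => ∫ y in A, t ^ m * g (q + t • (H • n + L y))) t := by
    intro t ht
    have ht0 : (0 : ℝ) < t := ht
    have h1 := Measure.integral_comp_smul (volume : Measure (E m))
      (fun y => f (q + ((H * t) • n + L y))) t
    have h2 : ∀ y : E m, f (q + ((H * t) • n + L (t • y))) = f (q + t • (H • n + L y)) := by
      intro y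
      rw [map_smul, smul_add, smul_smul, mul_comm t H]
    simp only [h2, finrank_euclideanSpace, Fintype.card_fin, smul_eq_mul] at h1
    have h3 : ∫ y : E m, f (q + ((H * t) • n + L y))
        = t ^ m * ∫ y : E m, f (q + t • (H • n + L y)) := by
      rw [h1, abs_of_pos (by positivity), ← mul_assoc, mul_inv_cancel₀ (by positivity), one_mul]
    rw [h3]
    by_cases ht1 : t ≤ 1
    · rw [indicator_of_mem (show t ∈ Ioc (0 : ℝ) 1 from ⟨ht0, ht1⟩), integral_const_mul]
      congr 1
      rw [← integral_indicator hA.measurableSet]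
      congr 1
      funext y
      by_cases hy : y ∈ A
      · rw [indicator_of_mem hy, hf, indicator_of_mem ((hpos t ht0 y).2 ⟨ht1, hy⟩)]
      · rw [indicator_of_notMem hy, hf, indicator_of_notMem (fun h => hy ((hpos t ht0 y).1 h).2)]
    · rw [indicator_of_notMem (fun h => ht1 h.2)]
      have : ∀ y, f (q + t • (H • n + L y)) = 0 := fun y =>
        indicator_of_notMem (fun h => ht1 ((hpos t ht0 y).1 h).1) _
      simp only [this, integral_zero, mul_zero]
  rw [e1, e2, e3, e4, setIntegral_congr_fun measurableSet_Ioi e5,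
    setIntegral_indicator measurableSet_Ioc]
  congr 3
  rw [inter_eq_right.2 Ioc_subset_Ioi_self]

/-- The divergence theorem for the field `ψ (x - q)` on a cone with apex `q`. -/
theorem setIntegral_cone_div {m : ℕ} {n q : E (m + 1)} {L : E m →ₗᵢ[ℝ] E (m + 1)}
    (hn : ‖n‖ = 1) (hL : ∀ y, inner ℝ n (L y) = 0)
    (hmp : MeasurePreserving (fun p : ℝ × E m => p.1 • n + L p.2) volume volume)
    {K : Set (E (m + 1))} {A : Set (E m)} {H : ℝ} (hH : 0 < H)
    (hK : IsCompact K) (hA : IsCompact A)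
    (hneg : ∀ s < (0 : ℝ), ∀ y, q + (s • n + L y) ∉ K)
    (hpos : ∀ t > (0 : ℝ), ∀ y, q + t • (H • n + L y) ∈ K ↔ t ≤ 1 ∧ y ∈ A)
    {ψ : E (m + 1) → ℝ} (hψ : ContDiff ℝ 1 ψ) :
    ∫ x in K, ((m + 1) * ψ x + fderiv ℝ ψ x (x - q)) = H * ∫ y in A, ψ (q + (H • n + L y)) := by
  have hfd : Continuous (fderiv ℝ ψ) := hψ.continuous_fderiv one_ne_zero
  have hψc : Continuous ψ := hψ.continuous
  have hg : Continuous (fun x => (m + 1) * ψ x + fderiv ℝ ψ x (x - q)) := by fun_prop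
  rw [setIntegral_cone hn hL hmp hH hK hA hneg hpos hg]
  congr 1
  have hcont : Continuous (fun z : ℝ × E m => z.1 ^ m *
      ((m + 1) * ψ (q + z.1 • (H • n + L z.2)) +
        fderiv ℝ ψ (q + z.1 • (H • n + L z.2)) (q + z.1 • (H • n + L z.2) - q))) := by
    have : Continuous (fun z : ℝ × E m => L z.2) := L.continuous.comp continuous_snd
    fun_prop
  rw [integral_integral_swap]
  · apply setIntegral_congr_fun hA.measurableSet
    intro y _
    dsimp only
    rw [← intervalIntegral.integral_of_le zero_le_one]
    -- Along the ray through y the weighted integrand is the derivative of t^(m+1) ψ. The lower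
    -- endpoint contributes nothing because the exponent is positive, so only the value on the base
    -- remains.
    have hder : ∀ t ∈ uIcc (0 : ℝ) 1,
        HasDerivAt (fun t : ℝ => t ^ (m + 1) * ψ (q + t • (H • n + L y)))
          (t ^ m * ((m + 1) * ψ (q + t • (H • n + L y)) +
          fderiv ℝ ψ (q + t • (H • n + L y)) (q + t • (H • n + L y) - q))) t := by
      intro t _
      have h1 : HasDerivAt (fun t : ℝ => q + t • (H • n + L y)) (H • n + L y) t := by
        have := ((hasDerivAt_id t).smul_const (H • n + L y)).const_add q
        simpa using this
      have h2 := ((hψ.differentiable one_ne_zero) (q + t • (H • n + L y))).hasFDerivAt.comp_hasDerivAt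
        t h1
      have h3 := (hasDerivAt_pow (m + 1) t).mul h2
      convert! h3 using 1
      rw [add_sub_cancel_left, (fderiv ℝ ψ _).map_smul]
      simp only [smul_eq_mul, Nat.cast_add, Nat.cast_one, Nat.add_sub_cancel, Function.comp]
      ring
    rw [intervalIntegral.integral_eq_sub_of_hasDerivAt hder]
    · simp
    · apply Continuous.intervalIntegrable
      exact hcont.comp (by fun_prop : Continuous (fun t : ℝ => (t, y)))
  · have h1 : IntegrableOn _ (Icc (0 : ℝ) 1 ×ˢ A) volume :=
      hcont.continuousOn.integrableOn_compact (isCompact_Icc.prod hA)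
    have h2 : IntegrableOn _ (Ioc (0 : ℝ) 1 ×ˢ A) volume := h1.mono_set (Set.prod_mono Ioc_subset_Icc_self subset_rfl : Ioc (0 : ℝ) 1 ×ˢ A ⊆ _)
    rw [IntegrableOn, Measure.volume_eq_prod, ← Measure.prod_restrict] at h2
    exact h2

/-! ### The divergence theorem on a simplex. -/

theorem isCompact_hull {d : ℕ} (K : Finset (E d)) : IsCompact (hull K) :=
  K.finite_toSet.isCompact_convexHull ℝ

theorem convex_hull {d : ℕ} (K : Finset (E d)) : Convex ℝ (hull K) := convex_convexHull ℝ _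

theorem subset_hull {d : ℕ} {K : Finset (E d)} {x : E d} (hx : x ∈ K) : x ∈ hull K :=
  subset_convexHull ℝ _ (Finset.mem_coe.2 hx)

theorem hull_mono {d : ℕ} {F K : Finset (E d)} (h : F ⊆ K) : hull F ⊆ hull K :=
  convexHull_mono (Finset.coe_subset.2 h)

/-- An affine equation which holds at the vertices holds on the simplex. -/
theorem inner_eq_of_mem_hull {d : ℕ} {F : Finset (E d)} {n p : E d} {c : ℝ}
    (h : ∀ x ∈ F, inner ℝ n (x - p) = c) {x : E d} (hx : x ∈ hull F) : inner ℝ n (x - p) = c := by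
  have hc : Convex ℝ {x : E d | inner ℝ n (x - p) = c} := by
    have : {x : E d | inner ℝ n (x - p) = c} = {x : E d | inner ℝ n x = c + inner ℝ n p} := by
      ext x
      simp only [mem_ofPred_eq, inner_sub_right, sub_eq_iff_eq_add]
    rw [this]
    exact convex_hyperplane (innerₛₗ ℝ n).isLinear _
  exact convexHull_min (fun x hx => h x (Finset.mem_coe.1 hx)) hc hx

/-- An affine inequality which holds at the vertices holds on the simplex. -/
theorem inner_le_of_mem_hull {d : ℕ} {F : Finset (E d)} {n p : E d} {c : ℝ}
    (h : ∀ x ∈ F, inner ℝ n (x - p) ≤ c) {x : E d} (hx : x ∈ hull F) : inner ℝ n (x - p) ≤ c := by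
  have hc : Convex ℝ {x : E d | inner ℝ n (x - p) ≤ c} := by
    have : {x : E d | inner ℝ n (x - p) ≤ c} = {x : E d | inner ℝ n x ≤ c + inner ℝ n p} := by
      ext x
      simp only [mem_ofPred_eq, inner_sub_right, sub_le_iff_le_add]
    rw [this]
    exact convex_halfSpace_le (innerₛₗ ℝ n).isLinear _
  exact convexHull_min (fun x hx => h x (Finset.mem_coe.1 hx)) hc hx

/-- The divergence theorem for the field `ψ (x - q)` on a simplex with vertex `q`. -/
theorem setIntegral_hull_div_vertex {m : ℕ} {K : Finset (E (m + 1))} {q n : E (m + 1)} (hq : q ∈ K)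
    (hF : (K.erase q).Nonempty) (hn : IsOutwardNormal K (K.erase q) n) :
    IsFiniteMeasure (surf (K.erase q)) ∧
    ∃ H : ℝ, (∀ y ∈ K.erase q, inner ℝ n (y - q) = H) ∧
      ∀ ψ : E (m + 1) → ℝ, ContDiff ℝ 1 ψ →
        ∫ x in hull K, ((m + 1) * ψ x + fderiv ℝ ψ x (x - q))
          = H * ∫ y, ψ y ∂(surf (K.erase q)) := by
  obtain ⟨hn1, hn2, hn3⟩ := hn
  obtain ⟨L, hL, hsurj, hmp⟩ := exists_hyperplane_coordinates hn1
  set F := K.erase q with hFdef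
  obtain ⟨x₀, hx₀⟩ := hF
  set H := inner ℝ n (x₀ - q) with hHdef
  have hH : 0 < H := by
    have := hn3 x₀ hx₀ q hq (by simp [hFdef])
    rw [← neg_sub, inner_neg_right] at this
    linarith
  have hHF : ∀ y ∈ F, inner ℝ n (y - q) = H := by
    intro y hy
    have := hn2 y hy x₀ hx₀
    rw [← sub_add_sub_cancel y x₀ q, inner_add_right, this, zero_add]
  have hHF' : ∀ y ∈ hull F, inner ℝ n (y - q) = H := fun y hy => inner_eq_of_mem_hull hHF hy
  -- ι parametrises the hyperplane of the facet isometrically; H is the distance of q from it.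
  let ι : E m → E (m + 1) := fun y => q + (H • n + L y)
  have hιi : Isometry ι := by
    refine Isometry.of_dist_eq fun y y' => ?_
    simp [ι]
  have hιm : MeasurableEmbedding ι := hιi.isClosedEmbedding.measurableEmbedding
  let A : Set (E m) := ι ⁻¹' hull F
  have hA : IsCompact A := hιi.isClosedEmbedding.isCompact_preimage (isCompact_hull F)
  have hrange : hull F ⊆ range ι := by
    intro y hy
    obtain ⟨z, hz⟩ := hsurj (y - q - H • n) (by
      rw [inner_sub_right, hHF' y hy, real_inner_smul_right, real_inner_self_eq_norm_sq, hn1]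
      ring)
    exact ⟨z, by simp [ι, hz]⟩
  -- Isometries transport normalised Hausdorff measure, which on `E m` is Lebesgue measure; the
  -- dimension (m + 1) - 1 in `surf` reduces to m.
  have hsurf : surf F = Measure.map ι (volume.restrict A) := by
    have h1 := hιi.map_euclideanHausdorffMeasure (d := m)
    rw [EuclideanSpace.euclideanHausdorffMeasure_eq_volume] at h1
    rw [← hιm.restrict_map, h1, Measure.restrict_restrict (isCompact_hull F).measurableSet,
      inter_eq_left.2 hrange]
    rfl
  have hKins : hull K = convexJoin ℝ {q} (hull F) := by
    have : (K : Set (E (m + 1))) = insert q (F : Set (E (m + 1))) := by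
      rw [hFdef, ← Finset.coe_insert, Finset.insert_erase hq]
    rw [hull, this, convexHull_insert ⟨x₀, Finset.mem_coe.2 hx₀⟩]
    rfl
  have hmem : ∀ x, x ∈ hull K ↔ ∃ τ : ℝ, 0 ≤ τ ∧ τ ≤ 1 ∧ ∃ z ∈ hull F, x = q + τ • (z - q) := by
    intro x
    rw [hKins, mem_convexJoin]
    constructor
    · rintro ⟨q', hq', z, hz, hx⟩
      rw [mem_singleton_iff.1 hq', segment_eq_image'] at hx
      obtain ⟨τ, hτ, rfl⟩ := hx
      exact ⟨τ, hτ.1, hτ.2, z, hz, rfl⟩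
    · rintro ⟨τ, h0, h1, z, hz, rfl⟩
      refine ⟨q, rfl, z, hz, ?_⟩
      rw [segment_eq_image']
      exact ⟨τ, ⟨h0, h1⟩, rfl⟩
  have hneg : ∀ s < (0 : ℝ), ∀ y, q + (s • n + L y) ∉ hull K := by
    intro s hs y h
    obtain ⟨τ, h0, h1, z, hz, hx⟩ := (hmem _).1 h
    have h2 := congrArg (fun w => inner ℝ n w) (add_left_cancel hx)
    simp only [inner_add_right, real_inner_smul_right, hL, real_inner_self_eq_norm_sq, hn1,
      hHF' z hz] at h2
    nlinarith [mul_nonneg h0 hH.le]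
  have hpos : ∀ t > (0 : ℝ), ∀ y, q + t • (H • n + L y) ∈ hull K ↔ t ≤ 1 ∧ y ∈ A := by
    intro t ht y
    rw [hmem]
    constructor
    · rintro ⟨τ, h0, h1, z, hz, hx⟩
      have hx' := add_left_cancel hx
      have h2 := congrArg (fun w => inner ℝ n w) hx'
      simp only [inner_add_right, real_inner_smul_right, hL, real_inner_self_eq_norm_sq, hn1,
        hHF' z hz] at h2
      -- Comparing components along n: both representations of the point have the same height, t H =
      -- τ H.
      have h3 : t = τ := by
        apply mul_right_cancel₀ hH.ne'
        linarith
      subst h3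
      have h4 : H • n + L y = z - q := by
        exact smul_right_injective (E (m + 1)) ht.ne' hx'
      refine ⟨h1, ?_⟩
      change q + (H • n + L y) ∈ hull F
      rw [h4]
      simpa using hz
    · rintro ⟨h1, hy⟩
      exact ⟨t, ht.le, h1, ι y, hy, by simp [ι]⟩
  refine ⟨?_, H, hHF, ?_⟩
  · rw [hsurf]
    have : IsFiniteMeasure (volume.restrict A) := ⟨by simpa using hA.measure_lt_top⟩
    infer_instance
  · intro ψ hψ
    rw [setIntegral_cone_div hn1 hL hmp hH (isCompact_hull K) hA hneg hpos hψ, hsurf,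
      hιm.integral_map]

/-- The divergence theorem on a simplex. -/
theorem setIntegral_hull_fderiv {m : ℕ} {K : Finset (E (m + 1))}
    (hK : AffineIndependent ℝ ((↑) : K → E (m + 1))) (hc : K.card = m + 2)
    {ψ : E (m + 1) → ℝ} (hψ : ContDiff ℝ 1 ψ) (v : E (m + 1)) :
    ∫ x in hull K, fderiv ℝ ψ x v
      = ∑ q ∈ K, inner ℝ (normal K (K.erase q)) v * ∫ y, ψ y ∂(surf (K.erase q)) := by
  have hfd : Continuous (fderiv ℝ ψ) := hψ.continuous_fderiv one_ne_zero
  have hψc : Continuous ψ := hψ.continuous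
  have hint : ∀ g : E (m + 1) → ℝ, Continuous g → IntegrableOn g (hull K) := fun g hg =>
    hg.continuousOn.integrableOn_compact (isCompact_hull K)
  have hcard : ∀ q ∈ K, (K.erase q).card = m + 1 := fun q hq => by
    rw [Finset.card_erase_of_mem hq, hc]; rfl
  have hne : ∀ q ∈ K, (K.erase q).Nonempty := fun q hq => by
    rw [← Finset.card_pos, hcard q hq]; omega
  have hno : ∀ q ∈ K, IsOutwardNormal K (K.erase q) (normal K (K.erase q)) := fun q hq =>
    normal_spec hK (Finset.erase_subset _ _) (hne q hq) (by rw [hcard q hq, hc])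
  have hcone := fun q (hq : q ∈ K) => (setIntegral_hull_div_vertex hq (hne q hq) (hno q hq)).2
  choose! H hH hdiv using hcone
  -- Relative to a vertex p, the component along the normal opposite p is constant on the other
  -- vertices and zero at p. Hence for an edge vector q' - q only the facets opposite q and q'
  -- contribute.
  have hin : ∀ p ∈ K, ∀ x ∈ K, inner ℝ (normal K (K.erase p)) (x - p) = H p - if x = p then H p
      else 0 := by
    intro p hp x hx
    by_cases h : x = p
    · simp [h]
    · simp [h, hH p hp x (Finset.mem_erase.2 ⟨h, hx⟩)]
  have hspan : v ∈ vectorSpan ℝ (K : Set (E (m + 1))) := by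
    have h1 : vectorSpan ℝ (Set.range ((↑) : K → E (m + 1))) = ⊤ := by
      apply hK.vectorSpan_eq_top_of_card_eq_finrank_add_one
      simp [hc]
    have h2 : Set.range ((↑) : K → E (m + 1)) = (K : Set (E (m + 1))) := Subtype.range_coe
    rw [← h2, h1]
    trivial
  rw [vectorSpan_def] at hspan
  induction hspan using Submodule.span_induction with
  | mem w hw =>
    obtain ⟨q', hq', q, hq, rfl⟩ := Set.mem_vsub.1 hw
    have hq1 : q ∈ K := Finset.mem_coe.1 hq
    have hq1' : q' ∈ K := Finset.mem_coe.1 hq'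
    -- Subtract the cone formulas with apexes q and q': the terms (m + 1)ψ cancel and (x - q) - (x -
    -- q') = q' - q.
    have e1 : ∫ x in hull K, fderiv ℝ ψ x (q' -ᵥ q)
        = H q * (∫ y, ψ y ∂(surf (K.erase q))) - H q' * ∫ y, ψ y ∂(surf (K.erase q')) := by
      rw [← hdiv q hq1 ψ hψ, ← hdiv q' hq1' ψ hψ, ← integral_sub (hint _ (by fun_prop))
        (hint _ (by fun_prop))]
      congr 1
      funext x
      rw [add_sub_add_left_eq_sub, ← map_sub, vsub_eq_sub, sub_sub_sub_cancel_left]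
    rw [e1]
    have e2 : ∀ p ∈ K, inner ℝ (normal K (K.erase p)) (q' -ᵥ q) * ∫ y, ψ y ∂(surf (K.erase p))
        = (if q = p then H p * ∫ y, ψ y ∂(surf (K.erase p)) else 0)
          - if q' = p then H p * ∫ y, ψ y ∂(surf (K.erase p)) else 0 := by
      intro p hp
      rw [vsub_eq_sub, ← sub_sub_sub_cancel_right q' q p, inner_sub_right, hin p hp q hq1,
        hin p hp q' hq1']
      split_ifs <;> ring
    rw [Finset.sum_congr rfl e2, Finset.sum_sub_distrib, Finset.sum_ite_eq, Finset.sum_ite_eq,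
      if_pos hq1, if_pos hq1']
  | zero => simp
  | add x y _ _ hx hy =>
    simp only [map_add, inner_add_right, add_mul, Finset.sum_add_distrib]
    rw [integral_add (hint _ (by fun_prop)) (hint _ (by fun_prop)), hx, hy]
  | smul a x _ hx =>
    simp only [map_smul, smul_eq_mul, real_inner_smul_right, mul_assoc, ← Finset.mul_sum]
    rw [integral_const_mul, hx]

/-! ### Polynomials and the inverse inequality. -/

open Triangulation (ev)

theorem contDiff_ev {d : ℕ} (p : MvPolynomial (Fin d) ℝ) : ContDiff ℝ ∞ (ev p) := by
  induction p using MvPolynomial.induction_on with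
  | C a =>
    have : ev (MvPolynomial.C a) = fun _ : E d => a := by
      funext x
      simp [ev]
    rw [this]
    exact contDiff_const
  | add p q hp hq =>
    have : ev (p + q) = fun x => ev p x + ev q x := by
      funext x
      simp [ev]
    rw [this]
    exact hp.add hq
  | mul_X p i hp =>
    have : ev (p * MvPolynomial.X i) = fun x : E d => ev p x * x i := by
      funext x
      simp [ev]
    rw [this]
    exact hp.mul (by fun_prop)

theorem continuous_ev {d : ℕ} (p : MvPolynomial (Fin d) ℝ) : Continuous (ev p) :=
  (contDiff_ev p).continuous

theorem differentiable_ev {d : ℕ} (p : MvPolynomial (Fin d) ℝ) : Differentiable ℝ (ev p) :=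
  (contDiff_ev p).differentiable (by simp)

theorem pd_ev {d : ℕ} (i : Fin d) (p : MvPolynomial (Fin d) ℝ) (x : E d) :
    pd i (ev p) x = ev (MvPolynomial.pderiv i p) x := by
  induction p using MvPolynomial.induction_on with
  | C a =>
    have : ev (MvPolynomial.C a) = fun _ : E d => a := by
      funext x
      simp [ev]
    rw [this, MvPolynomial.pderiv_C]
    simp [pd, ev]
  | add p q hp hq =>
    have : ev (p + q) = ev p + ev q := by
      funext x
      simp [ev]
    rw [this, pd, fderiv_add (differentiable_ev p x) (differentiable_ev q x)]
    simp only [pd] at hp hq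
    simp [hp, hq, ev]
  | mul_X p j hp =>
    have : ev (p * MvPolynomial.X j) = ev p * fun x : E d => x j := by
      funext x
      simp [ev]
    have h2 : HasFDerivAt (fun x : E d => x j) (EuclideanSpace.proj j : E d →L[ℝ] ℝ) x :=
      (EuclideanSpace.proj j : E d →L[ℝ] ℝ).hasFDerivAt
    rw [this, pd, fderiv_mul (differentiable_ev p x) h2.differentiableAt, h2.fderiv]
    simp only [pd] at hp
    by_cases hij : j = i
    · subst hij
      simp [hp, ev, Derivation.leibniz]
    · simp [hp, ev, Derivation.leibniz, hij, MvPolynomial.pderiv_X_of_ne hij]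

/-- A polynomial which vanishes almost everywhere on a ball is zero. -/
theorem eq_zero_of_ev_ae_eq_zero {d : ℕ} {r : ℝ} (hr : 0 < r) {p : MvPolynomial (Fin d) ℝ}
    (h : ev p =ᵐ[volume.restrict (Metric.closedBall 0 r)] 0) : p = 0 := by
  have h1 : EqOn (ev p) 0 (Metric.ball 0 r) :=
    Measure.eqOn_open_of_ae_eq
      (ae_restrict_of_ae_restrict_of_subset Metric.ball_subset_closedBall h)
      Metric.isOpen_ball (continuous_ev p).continuousOn continuousOn_const
  -- A Euclidean ball contains a coordinate cube, and a polynomial vanishing on a product of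
  -- infinite sets is zero.
  obtain ⟨ε, hε, hsub⟩ : ∃ ε > 0, ∀ x : Fin d → ℝ, (∀ i, |x i| < ε) →
      WithLp.toLp 2 x ∈ Metric.ball (0 : E d) r := by
    have hc : Continuous (fun x : Fin d → ℝ => (WithLp.toLp 2 x : E d)) := PiLp.continuous_toLp 2 _
    have h2 : (fun x : Fin d → ℝ => (WithLp.toLp 2 x : E d)) ⁻¹' Metric.ball 0 r ∈ 𝓝 0 :=
      hc.continuousAt.preimage_mem_nhds (by
        rw [WithLp.toLp_zero]
        exact Metric.ball_mem_nhds _ hr)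
    obtain ⟨ε, hε, hb⟩ := Metric.mem_nhds_iff.1 h2
    refine ⟨ε, hε, fun x hx => hb ?_⟩
    rw [mem_ball_zero_iff, pi_norm_lt_iff hε]
    exact hx
  apply MvPolynomial.funext_set (fun _ => Ioo (-ε) ε) (fun _ => Ioo_infinite (by linarith))
  intro x hx
  have h3 := h1 (hsub x fun i => abs_lt.2 (hx i (mem_univ i)))
  simpa [ev] using h3

/-- Substituting an affine change of variables in a polynomial does not increase the degree. -/
theorem exists_ev_comp_affine {d : ℕ} (p : MvPolynomial (Fin d) ℝ) (x : E d) (h : ℝ) :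
    ∃ q : MvPolynomial (Fin d) ℝ, q.totalDegree ≤ p.totalDegree ∧
      ∀ y, ev q y = ev p (x + h • y) := by
  refine ⟨∑ s ∈ p.support, MvPolynomial.C (p.coeff s) *
    ∏ i, (MvPolynomial.C (x i) + MvPolynomial.C h * MvPolynomial.X i) ^ s i, ?_, ?_⟩
  · refine MvPolynomial.totalDegree_finsetSum_le fun s hs => ?_
    refine (MvPolynomial.totalDegree_mul _ _).trans ?_
    rw [MvPolynomial.totalDegree_C, zero_add]
    refine (MvPolynomial.totalDegree_finsetProd _ _).trans ?_
    refine le_trans (Finset.sum_le_sum (g := fun i => s i) fun i _ => ?_) ?_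
    · refine (MvPolynomial.totalDegree_pow _ _).trans ?_
      have : (MvPolynomial.C (x i) + MvPolynomial.C h * MvPolynomial.X i :
          MvPolynomial (Fin d) ℝ).totalDegree ≤ 1 := by
        refine (MvPolynomial.totalDegree_add _ _).trans (max_le (by simp) ?_)
        refine (MvPolynomial.totalDegree_mul _ _).trans ?_
        simp
      nlinarith
    · have := MvPolynomial.le_totalDegree hs
      rwa [Finsupp.sum_fintype _ _ (fun _ => rfl)] at this
  · intro y
    rw [ev, map_sum, ev, MvPolynomial.eval_eq']
    refine Finset.sum_congr rfl fun s _ => ?_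
    simp [map_prod]

theorem totalDegree_pderiv_le {d : ℕ} (i : Fin d) (p : MvPolynomial (Fin d) ℝ) :
    (MvPolynomial.pderiv i p).totalDegree ≤ p.totalDegree := by
  conv_lhs => rw [p.as_sum, map_sum]
  refine MvPolynomial.totalDegree_finsetSum_le fun s hs => ?_
  rw [MvPolynomial.pderiv_monomial]
  refine (MvPolynomial.totalDegree_monomial_le _ _).trans
    (le_trans ?_ (MvPolynomial.le_totalDegree hs))
  rw [Finsupp.sum_fintype _ _ (fun _ => rfl), Finsupp.sum_fintype _ _ (fun _ => rfl)]
  exact Finset.sum_le_sum fun j _ => by simp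

/-- For linear maps on a finite-dimensional space, the norm of one is bounded by the norm of
another if the latter is injective. -/
theorem exists_norm_le_of_injective {V X Y : Type*} [AddCommGroup V] [Module ℝ V]
    [FiniteDimensional ℝ V] [NormedAddCommGroup X] [NormedSpace ℝ X] [NormedAddCommGroup Y]
    [NormedSpace ℝ Y] (A : V →ₗ[ℝ] X) (B : V →ₗ[ℝ] Y) (hB : Function.Injective B) :
    ∃ C : ℝ, 0 < C ∧ ∀ v, ‖A v‖ ≤ C * ‖B v‖ := by
  let e := LinearEquiv.ofInjective B hB
  -- A ∘ B⁻¹ on the finite-dimensional range of B is automatically bounded. Adding 1 to its norm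
  -- keeps the constant positive.
  let A' : LinearMap.range B →L[ℝ] X := (A ∘ₗ e.symm.toLinearMap).toContinuousLinearMap
  refine ⟨‖A'‖ + 1, by positivity, fun v => ?_⟩
  have h1 : A' (e v) = A v := by simp [A']
  have h2 : ‖e v‖ = ‖B v‖ := rfl
  rw [← h1, ← h2]
  exact (A'.le_opNorm _).trans (by gcongr; simp)

theorem memLp_of_continuous {d : ℕ} {f : E d → ℝ} (hf : Continuous f) {s : Set (E d)}
    (hs : IsCompact s) {μ : Measure (E d)} [IsFiniteMeasureOnCompacts μ] :
    MemLp f 2 (μ.restrict s) :=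
  (memLp_two_iff_integrable_sq hf.aestronglyMeasurable).2
    ((hf.pow 2).continuousOn.integrableOn_compact hs)

theorem norm_toLp_sq {X : Type*} [MeasurableSpace X] {μ : Measure X} {f : X → ℝ}
    (hf : MemLp f 2 μ) : ‖hf.toLp f‖ ^ 2 = ∫ x, f x ^ 2 ∂μ := by
  rw [← real_inner_self_eq_norm_sq, L2.inner_def]
  refine integral_congr_ae ?_
  filter_upwards [hf.coeFn_toLp] with x hx
  rw [hx]
  simp [sq]

/-- The inverse inequality on balls around the origin. -/
theorem exists_inverse_ball {d : ℕ} (k : ℕ) {r : ℝ} (hr : 0 < r) (i : Fin d) :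
    ∃ C : ℝ, 0 < C ∧ ∀ p : MvPolynomial (Fin d) ℝ, p.totalDegree ≤ k →
      ∫ x in Metric.closedBall 0 1, ev (MvPolynomial.pderiv i p) x ^ 2
        ≤ C * ∫ x in Metric.closedBall 0 r, ev p x ^ 2 := by
  have hc : ∀ (p : MvPolynomial (Fin d) ℝ) (r : ℝ),
      MemLp (ev p) 2 (volume.restrict (Metric.closedBall 0 r)) := fun p r =>
    memLp_of_continuous (continuous_ev p) (isCompact_closedBall _ _)
  have hadd : ∀ (p q : MvPolynomial (Fin d) ℝ), ev (p + q) = ev p + ev q := fun p q => by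
    funext x
    simp [ev]
  have hsmul : ∀ (a : ℝ) (p : MvPolynomial (Fin d) ℝ), ev (a • p) = a • ev p := fun a p => by
    funext x
    simp [ev, MvPolynomial.smul_eval]
  let J (r : ℝ) : MvPolynomial (Fin d) ℝ →ₗ[ℝ]
      Lp ℝ 2 ((volume : Measure (E d)).restrict (Metric.closedBall 0 r)) :=
    { toFun := fun p => (hc p r).toLp _
      map_add' := fun p q => by
        rw [← MemLp.toLp_add]
        exact MemLp.toLp_congr _ _ (by rw [hadd])
      map_smul' := fun a p => by
        rw [RingHom.id_apply, ← MemLp.toLp_const_smul]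
        exact MemLp.toLp_congr _ _ (by rw [hsmul]) }
  let V := MvPolynomial.restrictTotalDegree (Fin d) ℝ k
  obtain ⟨C, hC, h⟩ := exists_norm_le_of_injective
    -- On polynomials of degree at most k, compare p ↦ ∂ᵢp in L² of the unit ball with p ↦ p in L²
    -- of the ball of radius r. The second map is injective because a ball determines a polynomial.
    ((J 1 ∘ₗ (MvPolynomial.pderiv i).toLinearMap) ∘ₗ V.subtype) (J r ∘ₗ V.subtype) (by
      rw [← LinearMap.ker_eq_bot, LinearMap.ker_eq_bot']
      intro p hp
      have h1 : (hc p.1 r).toLp _ = 0 := hp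
      have h2 := (hc p.1 r).coeFn_toLp
      rw [h1] at h2
      exact Subtype.ext (eq_zero_of_ev_ae_eq_zero hr (h2.symm.trans (Lp.coeFn_zero _ _ _))))
  refine ⟨C ^ 2, by positivity, fun p hp => ?_⟩
  have h1 := h ⟨p, (MvPolynomial.mem_restrictTotalDegree _ _ _).2 hp⟩
  change ‖(hc (MvPolynomial.pderiv i p) 1).toLp _‖ ≤ C * ‖(hc p r).toLp _‖ at h1
  rw [← norm_toLp_sq (hc _ 1), ← norm_toLp_sq (hc p r), ← mul_pow]
  gcongr

theorem setIntegral_closedBall_scale {d : ℕ} (f : E d → ℝ) (x : E d) {h r : ℝ} (hh : 0 < h) :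
    ∫ z in Metric.closedBall x (h * r), f z
      = h ^ d * ∫ y in Metric.closedBall 0 r, f (x + h • y) := by
  have h1 := Measure.setIntegral_comp_smul_of_pos (volume : Measure (E d)) (fun y => f (x + y))
    (Metric.closedBall 0 r) hh
  rw [h1, smul_closedBall' hh.ne', finrank_euclideanSpace_fin, smul_eq_mul, ← mul_assoc,
    mul_inv_cancel₀ (by positivity), one_mul, smul_zero, Real.norm_of_nonneg hh.le]
  have h2 := (measurePreserving_add_left (volume : Measure (E d)) x).setIntegral_preimage_emb
    (measurableEmbedding_addLeft x) f (Metric.closedBall x (h * r))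
  rw [← h2]
  congr 2
  ext y
  simp

/-- The inverse inequality on a set which is comparable to a ball of radius `h`. -/
theorem exists_inverse_inequality {d : ℕ} (k : ℕ) {σ : ℝ} (hσ : 0 < σ) :
    ∃ C : ℝ, 0 < C ∧ ∀ (s : Set (E d)) (x : E d) (h : ℝ), IsCompact s → 0 < h →
      Metric.closedBall x (h / σ) ⊆ s → s ⊆ Metric.closedBall x h →
      ∀ (i : Fin d) (p : MvPolynomial (Fin d) ℝ), p.totalDegree ≤ k →
      h ^ 2 * ∫ z in s, ev (MvPolynomial.pderiv i p) z ^ 2 ≤ C * ∫ z in s, ev p z ^ 2 := by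
  have hb := fun i : Fin d => exists_inverse_ball k (inv_pos.2 hσ) i
  choose C hC hCb using hb
  -- One constant for all directions i; the 1 secures positivity without any condition on d.
  refine ⟨1 + ∑ i, C i, ?_, ?_⟩
  · have := Finset.sum_nonneg fun i (_ : i ∈ Finset.univ) => (hC i).le
    positivity
  intro s x h hs hh h1 h2 i p hp
  obtain ⟨q, hq, hqe⟩ := exists_ev_comp_affine p x h
  -- The chain rule yields one factor h, which accounts exactly for the h² in front of the squared
  -- derivative.
  have hder : ∀ y, ev (MvPolynomial.pderiv i q) y = h * ev (MvPolynomial.pderiv i p) (x + h • y) := by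
    intro y
    rw [← pd_ev, ← pd_ev]
    have h3 : ev q = fun y => ev p (x + h • y) := funext hqe
    have h4 : HasFDerivAt (fun y : E d => x + h • y) (h • ContinuousLinearMap.id ℝ (E d)) y :=
      ((hasFDerivAt_id y).const_smul h).const_add x
    have h5 := (differentiable_ev p (x + h • y)).hasFDerivAt.comp y h4
    rw [pd, h3, pd]
    have h6 : fderiv ℝ (fun y => ev p (x + h • y)) y = _ := h5.fderiv
    rw [h6]
    simp
  have hint : ∀ (p : MvPolynomial (Fin d) ℝ) {s : Set (E d)}, IsCompact s →
      IntegrableOn (fun z => ev p z ^ 2) s := fun p s hs =>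
    ((continuous_ev p).pow 2).continuousOn.integrableOn_compact hs
  have e1 : h ^ 2 * ∫ z in s, ev (MvPolynomial.pderiv i p) z ^ 2
      ≤ h ^ 2 * ∫ z in Metric.closedBall x (h * 1), ev (MvPolynomial.pderiv i p) z ^ 2 := by
    rw [mul_one]
    exact mul_le_mul_of_nonneg_left (setIntegral_mono_set (hint _ (isCompact_closedBall _ _))
      (Eventually.of_forall fun z => sq_nonneg _) h2.eventuallyLE) (sq_nonneg h)
  have e2 : h ^ 2 * ∫ z in Metric.closedBall x (h * 1), ev (MvPolynomial.pderiv i p) z ^ 2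
      = h ^ d * ∫ y in Metric.closedBall 0 1, ev (MvPolynomial.pderiv i q) y ^ 2 := by
    rw [setIntegral_closedBall_scale _ _ hh, mul_left_comm, ← integral_const_mul]
    simp only [hder, mul_pow]
  have e3 : h ^ d * ∫ y in Metric.closedBall 0 σ⁻¹, ev q y ^ 2
      = ∫ z in Metric.closedBall x (h / σ), ev p z ^ 2 := by
    rw [div_eq_mul_inv, setIntegral_closedBall_scale _ _ hh]
    simp only [hqe]
  have e4 : ∫ z in Metric.closedBall x (h / σ), ev p z ^ 2 ≤ ∫ z in s, ev p z ^ 2 :=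
    setIntegral_mono_set (hint _ hs)
      (Eventually.of_forall fun z => sq_nonneg _) h1.eventuallyLE
  have e5 := hCb i q (hq.trans hp)
  have e6 : C i ≤ 1 + ∑ i, C i := by
    have := Finset.single_le_sum (fun i _ => (hC i).le) (Finset.mem_univ i)
    linarith
  have e7 : 0 ≤ ∫ z in s, ev p z ^ 2 := integral_nonneg fun z => sq_nonneg _
  calc _ ≤ _ := e1
    _ = _ := e2
    _ ≤ h ^ d * (C i * ∫ y in Metric.closedBall 0 σ⁻¹, ev q y ^ 2) := by gcongr
    _ = C i * ∫ z in Metric.closedBall x (h / σ), ev p z ^ 2 := by rw [mul_left_comm, e3]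
    _ ≤ C i * ∫ z in s, ev p z ^ 2 := by
      have := (hC i).le
      gcongr
    _ ≤ _ := by gcongr

/-! ### Convergence in `L²` -/

section L2

variable {X : Type*} [MeasurableSpace X] {μ : Measure X}

theorem integral_mul_eq_inner {f g : X → ℝ} (hf : MemLp f 2 μ) (hg : MemLp g 2 μ) :
    ∫ x, f x * g x ∂μ = inner ℝ (hf.toLp f) (hg.toLp g) := by
  rw [L2.inner_def]
  refine integral_congr_ae ?_
  filter_upwards [hf.coeFn_toLp, hg.coeFn_toLp] with x hx hy
  rw [hx, hy]
  simp [mul_comm]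

/-- The integral of a product is an inner product in L², which is jointly continuous. This carries
formulas for smooth functions over to traces. -/
theorem tendsto_integral_mul {f : X → ℝ} {φ : ℕ → X → ℝ} (hf : MemLp f 2 μ)
    (hφ : ∀ n, MemLp (φ n) 2 μ)
    (h : Tendsto (fun n => eLpNorm (fun x => φ n x - f x) 2 μ) atTop (𝓝 0))
    {g : X → ℝ} {γ : ℕ → X → ℝ} (hg : MemLp g 2 μ) (hγ : ∀ n, MemLp (γ n) 2 μ)
    (h' : Tendsto (fun n => eLpNorm (fun x => γ n x - g x) 2 μ) atTop (𝓝 0)) :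
    Tendsto (fun n => ∫ x, φ n x * γ n x ∂μ) atTop (𝓝 (∫ x, f x * g x ∂μ)) := by
  have h1 : Tendsto (fun n => (hφ n).toLp (φ n)) atTop (𝓝 (hf.toLp f)) :=
    (Lp.tendsto_Lp_iff_tendsto_eLpNorm'' φ hφ f hf).2 h
  have h2 : Tendsto (fun n => (hγ n).toLp (γ n)) atTop (𝓝 (hg.toLp g)) :=
    (Lp.tendsto_Lp_iff_tendsto_eLpNorm'' γ hγ g hg).2 h'
  rw [integral_mul_eq_inner hf hg]
  simp only [integral_mul_eq_inner (hφ _) (hγ _)]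
  exact h1.inner h2

theorem tendsto_integral_mul_const {f : X → ℝ} {φ : ℕ → X → ℝ} (hf : MemLp f 2 μ)
    (hφ : ∀ n, MemLp (φ n) 2 μ)
    (h : Tendsto (fun n => eLpNorm (fun x => φ n x - f x) 2 μ) atTop (𝓝 0))
    {g : X → ℝ} (hg : MemLp g 2 μ) :
    Tendsto (fun n => ∫ x, φ n x * g x ∂μ) atTop (𝓝 (∫ x, f x * g x ∂μ)) :=
  tendsto_integral_mul hf hφ h hg (fun _ => hg) (by simp)

theorem tendsto_integral_sq {f : X → ℝ} {φ : ℕ → X → ℝ} (hf : MemLp f 2 μ)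
    (hφ : ∀ n, MemLp (φ n) 2 μ)
    (h : Tendsto (fun n => eLpNorm (fun x => φ n x - f x) 2 μ) atTop (𝓝 0)) :
    Tendsto (fun n => ∫ x, φ n x ^ 2 ∂μ) atTop (𝓝 (∫ x, f x ^ 2 ∂μ)) := by
  simpa only [sq] using tendsto_integral_mul hf hφ h hf hφ h

theorem tendsto_eLpNorm_sub_add {F : Type*} [NormedAddCommGroup F] {f g : X → F}
    {φ γ : ℕ → X → F}
    (hf : ∀ n, AEStronglyMeasurable (fun x => φ n x - f x) μ)
    (hg : ∀ n, AEStronglyMeasurable (fun x => γ n x - g x) μ)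
    (h : Tendsto (fun n => eLpNorm (fun x => φ n x - f x) 2 μ) atTop (𝓝 0))
    (h' : Tendsto (fun n => eLpNorm (fun x => γ n x - g x) 2 μ) atTop (𝓝 0)) :
    Tendsto (fun n => eLpNorm (fun x => φ n x + γ n x - (f x + g x)) 2 μ) atTop (𝓝 0) := by
  have h1 : Tendsto (fun n => eLpNorm (fun x => φ n x - f x) 2 μ
      + eLpNorm (fun x => γ n x - g x) 2 μ) atTop (𝓝 0) := by
    simpa using h.add h'
  refine tendsto_of_tendsto_of_tendsto_of_le_of_le tendsto_const_nhds h1 (fun _ => zero_le) ?_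
  intro n
  have e : (fun x => φ n x + γ n x - (f x + g x))
      = (fun x => φ n x - f x) + fun x => γ n x - g x := by
    funext x
    simp only [Pi.add_apply]
    abel
  dsimp only
  rw [e]
  exact eLpNorm_add_le (hf n) (hg n) (by norm_num)

theorem tendsto_eLpNorm_sub_neg {F : Type*} [NormedAddCommGroup F] {f : X → F} {φ : ℕ → X → F}
    (h : Tendsto (fun n => eLpNorm (fun x => φ n x - f x) 2 μ) atTop (𝓝 0)) :
    Tendsto (fun n => eLpNorm (fun x => -φ n x - -f x) 2 μ) atTop (𝓝 0) := by
  refine h.congr fun n => ?_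
  rw [← eLpNorm_neg]
  congr 1
  funext x
  simp only [Pi.neg_apply]
  abel

end L2

/-! ### Smooth functions on a cell -/

theorem contDiff_pd {d : ℕ} {φ : E d → ℝ} (h : ContDiff ℝ ∞ φ) (i : Fin d) :
    ContDiff ℝ ∞ (pd i φ) := by
  have : ContDiff ℝ ∞ (fderiv ℝ φ) := h.fderiv_right (by simp)
  exact this.clm_apply contDiff_const

theorem pd_mul {d : ℕ} {φ ψ : E d → ℝ} (hφ : ContDiff ℝ ∞ φ) (hψ : ContDiff ℝ ∞ ψ) (i : Fin d)
    (x : E d) : pd i (fun x => φ x * ψ x) x = pd i φ x * ψ x + φ x * pd i ψ x := by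
  have h1 := hφ.differentiable (by simp) x
  have h2 := hψ.differentiable (by simp) x
  simp only [pd]
  rw [fderiv_fun_mul h1 h2]
  simp
  ring

theorem pd_add {d : ℕ} {φ ψ : E d → ℝ} (hφ : ContDiff ℝ ∞ φ) (hψ : ContDiff ℝ ∞ ψ) (i : Fin d)
    (x : E d) : pd i (fun x => φ x + ψ x) x = pd i φ x + pd i ψ x := by
  have h1 := hφ.differentiable (by simp) x
  have h2 := hψ.differentiable (by simp) x
  simp only [pd]
  rw [fderiv_fun_add h1 h2]
  simp

theorem pd_neg {d : ℕ} {φ : E d → ℝ} (i : Fin d) (x : E d) :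
    pd i (fun x => -φ x) x = -pd i φ x := by
  simp only [pd]
  rw [fderiv_fun_neg]
  simp

namespace Triangulation

variable {m : ℕ} {Ω : Set (E (m + 1))} (T : Triangulation Ω)

/-! ### Cells, their facets, and the trace inequality for smooth functions. -/

section Cells

variable {T}

theorem cell_mem_faces (K : T.Cell) : K.1 ∈ T.complex.faces :=
  T.finite.mem_toFinset.1 (Finset.mem_filter.1 K.2).1

theorem cell_card (K : T.Cell) : K.1.card = m + 2 := (Finset.mem_filter.1 K.2).2

theorem cell_indep (K : T.Cell) : AffineIndependent ℝ ((↑) : K.1 → E (m + 1)) :=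
  T.complex.indep (cell_mem_faces K)

theorem facet_mem_faces (F : T.Facet) : F.1 ∈ T.complex.faces :=
  T.finite.mem_toFinset.1 (Finset.mem_filter.1 F.2).1

theorem facet_card (F : T.Facet) : F.1.card = m + 1 := (Finset.mem_filter.1 F.2).2

theorem facet_nonempty (F : T.Facet) : F.1.Nonempty := by
  rw [← Finset.card_pos, facet_card F]; omega

theorem mem_facetsOf {K : T.Cell} {F : T.Facet} : F ∈ T.facetsOf K ↔ F.1 ⊆ K.1 := by
  simp [facetsOf]

theorem exists_cell_of_facet (F : T.Facet) : ∃ K : T.Cell, F ∈ T.facetsOf K := by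
  obtain ⟨t, ht, hsub, hc⟩ := T.pure F.1 (facet_mem_faces F)
  exact ⟨⟨t, Finset.mem_filter.2 ⟨T.finite.mem_toFinset.2 ht, hc⟩⟩, mem_facetsOf.2 hsub⟩

theorem isOutwardNormal_normal {K : T.Cell} {F : T.Facet} (h : F ∈ T.facetsOf K) :
    IsOutwardNormal K.1 F.1 (normal K.1 F.1) :=
  normal_spec (cell_indep K) (mem_facetsOf.1 h) (facet_nonempty F) (by
    rw [cell_card K, facet_card F])

theorem exists_facet_eq_erase {K : T.Cell} {F : T.Facet} (h : F ∈ T.facetsOf K) :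
    ∃ q ∈ K.1, F.1 = K.1.erase q := by
  have h1 : (K.1 \ F.1).card = 1 := by
    rw [Finset.card_sdiff_of_subset (mem_facetsOf.1 h), cell_card, facet_card]
    omega
  obtain ⟨q, hq⟩ := Finset.card_eq_one.1 h1
  have hqm : q ∈ K.1 \ F.1 := by rw [hq]; simp
  refine ⟨q, (Finset.mem_sdiff.1 hqm).1, ?_⟩
  rw [Finset.erase_eq, ← hq, Finset.sdiff_sdiff_eq_self (mem_facetsOf.1 h)]

/-- The facets of a simplex are obtained by deleting one vertex, and they belong to the complex
because it is closed under nonempty subsets. This links sums over mesh facets to the divergence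
theorem, which is indexed by opposite vertices. -/
theorem sum_facetsOf (K : T.Cell) (f : Finset (E (m + 1)) → ℝ) :
    ∑ F ∈ T.facetsOf K, f F.1 = ∑ q ∈ K.1, f (K.1.erase q) := by
  have hmem : ∀ q ∈ K.1, K.1.erase q ∈ T.facets := by
    intro q hq
    have hc : (K.1.erase q).card = m + 1 := by
      rw [Finset.card_erase_of_mem hq, cell_card]; rfl
    refine Finset.mem_filter.2 ⟨T.finite.mem_toFinset.2 ?_, hc⟩
    exact T.complex.down_closed (cell_mem_faces K) (Finset.erase_subset _ _)
      (Finset.card_pos.1 (by omega))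
  symm
  refine Finset.sum_bij (fun q hq => ⟨K.1.erase q, hmem q hq⟩) ?_ ?_ ?_ ?_
  · intro q hq
    exact mem_facetsOf.2 (Finset.erase_subset _ _)
  · intro q hq q' hq' h
    exact Finset.erase_injOn K.1 hq hq' (congrArg Subtype.val h)
  · intro F hF
    obtain ⟨q, hq, h⟩ := exists_facet_eq_erase hF
    exact ⟨q, hq, Subtype.ext h.symm⟩
  · intro q hq
    rfl

theorem isFiniteMeasure_surf (F : T.Facet) : IsFiniteMeasure (surf F.1) := by
  obtain ⟨K, hK⟩ := exists_cell_of_facet F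
  obtain ⟨q, hq, h⟩ := exists_facet_eq_erase hK
  have hn := isOutwardNormal_normal hK
  have hne := facet_nonempty F
  rw [h] at hn hne ⊢
  exact (setIntegral_hull_div_vertex hq hne hn).1

theorem memLp_surf_of_continuous {f : E (m + 1) → ℝ} (hf : Continuous f) (F : T.Facet) :
    MemLp f 2 (surf F.1) := by
  have := isFiniteMeasure_surf F
  have h1 : (surf F.1).restrict (hull F.1) = surf F.1 := by
    rw [surf, Measure.restrict_restrict (isCompact_hull F.1).measurableSet, inter_self]
  rw [← h1]
  exact memLp_of_continuous hf (isCompact_hull _)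

theorem size_pos (K : T.Cell) : 0 < size K.1 := by
  obtain ⟨x, hx, y, hy, hxy⟩ := Finset.one_lt_card.1 (show 1 < K.1.card by rw [cell_card]; omega)
  have h1 : dist x y ≤ Metric.diam (hull K.1) :=
    Metric.dist_le_diam_of_mem (isCompact_hull K.1).isBounded (subset_hull hx) (subset_hull hy)
  exact (dist_pos.2 hxy).trans_le h1

theorem hull_subset_closedBall (K : T.Cell) {x : E (m + 1)} (hx : x ∈ hull K.1) :
    hull K.1 ⊆ Metric.closedBall x (size K.1) := fun _ hy =>
  Metric.dist_le_diam_of_mem (isCompact_hull K.1).isBounded hy hx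

/-- The divergence theorem on a cell. -/
theorem setIntegral_cell_pd (K : T.Cell) {ψ : E (m + 1) → ℝ} (hψ : ContDiff ℝ ∞ ψ)
    (i : Fin (m + 1)) :
    ∫ x in hull K.1, pd i ψ x
      = ∑ F ∈ T.facetsOf K, normal K.1 F.1 i * ∫ y, ψ y ∂(surf F.1) := by
  rw [sum_facetsOf K (fun F => normal K.1 F i * ∫ y, ψ y ∂(surf F))]
  have h := setIntegral_hull_fderiv (cell_indep K) (cell_card K) (hψ.of_le (by simp))
    (EuclideanSpace.single i 1)
  simpa [pd, EuclideanSpace.inner_single_right] using h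

/-- On a facet, the normal component of the position relative to the centre of a ball inside the
cell is at least the radius of the ball. -/
theorem le_inner_normal {K : T.Cell} {F : T.Facet} (h : F ∈ T.facetsOf K) {x₀ : E (m + 1)} {r : ℝ}
    (hr : 0 ≤ r) (hb : Metric.closedBall x₀ r ⊆ hull K.1) {x : E (m + 1)} (hx : x ∈ hull F.1) :
    r ≤ inner ℝ (normal K.1 F.1) (x - x₀) := by
  obtain ⟨h1, h2, h3⟩ := isOutwardNormal_normal h
  obtain ⟨f, hf⟩ := facet_nonempty F
  have e1 : inner ℝ (normal K.1 F.1) (x - f) = 0 :=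
    inner_eq_of_mem_hull (fun y hy => h2 y hy f hf) hx
  -- The point of the ball farthest in the direction n still lies in the cell, hence not beyond the
  -- hyperplane of the facet.
  have e2 : inner ℝ (normal K.1 F.1) (x₀ + r • normal K.1 F.1 - f) ≤ 0 := by
    refine inner_le_of_mem_hull (F := K.1) (fun y hy => ?_) (hb ?_)
    · by_cases hyF : y ∈ F.1
      · exact (h2 y hyF f hf).le
      · exact (h3 f hf y hy hyF).le
    · simp [norm_smul, h1, abs_of_nonneg hr]
  have e3 : x₀ + r • normal K.1 F.1 - f = (x - f) - (x - x₀) + r • normal K.1 F.1 := by abel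
  rw [e3, inner_add_right, inner_sub_right, real_inner_smul_right, real_inner_self_eq_norm_sq,
    h1, e1] at e2
  linarith

/-- The trace inequality for smooth functions on a cell. -/
theorem trace_inequality_smooth (K : T.Cell) {x₀ : E (m + 1)} {r : ℝ} (hr : 0 ≤ r)
    (hb : Metric.closedBall x₀ r ⊆ hull K.1) {φ : E (m + 1) → ℝ} (hφ : ContDiff ℝ ∞ φ) :
    r * ∑ F ∈ T.facetsOf K, ∫ x, φ x ^ 2 ∂(surf F.1)
      ≤ 2 * (m + 1) * (∫ x in hull K.1, φ x ^ 2)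
        + size K.1 ^ 2 * ∑ i, ∫ x in hull K.1, pd i φ x ^ 2 := by
  have hx₀ : x₀ ∈ hull K.1 := hb (Metric.mem_closedBall_self hr)
  have hcoord : ∀ i, ContDiff ℝ ∞ (fun x : E (m + 1) => (x - x₀) i) := fun i => by fun_prop
  have hφ2 : ContDiff ℝ ∞ (fun x => φ x * φ x) := hφ.mul hφ
  have hψ : ∀ i, ContDiff ℝ ∞ (fun x : E (m + 1) => (φ x * φ x) * (x - x₀) i) := fun i =>
    hφ2.mul (hcoord i)
  have hpdc : ∀ i x, pd i (fun x : E (m + 1) => (x - x₀) i) x = 1 := by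
    intro i x
    have h2 : HasFDerivAt (fun x : E (m + 1) => (x - x₀) i)
        (EuclideanSpace.proj i : E (m + 1) →L[ℝ] ℝ) x :=
      (EuclideanSpace.proj i : E (m + 1) →L[ℝ] ℝ).hasFDerivAt.sub_const (x₀ i)
    rw [pd, h2.fderiv]
    simp
  have hint : ∀ g : E (m + 1) → ℝ, Continuous g → IntegrableOn g (hull K.1) := fun g hg =>
    hg.continuousOn.integrableOn_compact (isCompact_hull K.1)
  have hφc := hφ.continuous
  have hpc := fun i => (contDiff_pd hφ i).continuous
  have hints : ∀ (F : T.Facet) (g : E (m + 1) → ℝ), Continuous g → Integrable g (surf F.1) :=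
    fun F g hg => by
      have := isFiniteMeasure_surf F
      exact (memLp_surf_of_continuous hg F).integrable (by norm_num)
  -- The divergence theorem for φ²(x - x₀), one component at a time. On a facet its flux density is
  -- at least r φ².
  have hdiv := Finset.sum_congr rfl fun i (_ : i ∈ Finset.univ) => setIntegral_cell_pd K (hψ i) i
  rw [Finset.sum_comm] at hdiv
  have hleft : r * ∑ F ∈ T.facetsOf K, ∫ x, φ x ^ 2 ∂(surf F.1) ≤
      ∑ F ∈ T.facetsOf K, ∑ i, normal K.1 F.1 i * ∫ x, φ x * φ x * (x - x₀) i ∂(surf F.1) := by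
    rw [Finset.mul_sum]
    refine Finset.sum_le_sum fun F hF => ?_
    have e1 : ∑ i, normal K.1 F.1 i * ∫ x, φ x * φ x * (x - x₀) i ∂(surf F.1)
        = ∫ x, φ x ^ 2 * inner ℝ (normal K.1 F.1) (x - x₀) ∂(surf F.1) := by
      simp only [← integral_const_mul]
      rw [← integral_finsetSum]
      · congr 1
        funext x
        rw [PiLp.inner_apply, Finset.mul_sum]
        refine Finset.sum_congr rfl fun i _ => ?_
        simp
        ring
      · intro i _
        exact hints F _ (by fun_prop)
    rw [e1, ← integral_const_mul]
    refine integral_mono_ae (hints F _ (by fun_prop)) (hints F _ (by fun_prop)) ?_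
    rw [surf]
    filter_upwards [ae_restrict_mem (isCompact_hull F.1).measurableSet] with x hx
    have := le_inner_normal hF hr hb hx
    nlinarith [sq_nonneg (φ x)]
  refine hleft.trans (hdiv.symm.le.trans ?_)
  -- The i-th contribution to the divergence is φ² + 2φ ∂ᵢφ (x - x₀)ᵢ; Young's inequality and |(x -
  -- x₀)ᵢ| ≤ h give the bound. Summing over the m + 1 directions produces the factor 2(m + 1).
  have e2 : ∀ i, ∫ x in hull K.1, pd i (fun x : E (m + 1) => (φ x * φ x) * (x - x₀) i) x
      ≤ 2 * (∫ x in hull K.1, φ x ^ 2) + size K.1 ^ 2 * ∫ x in hull K.1, pd i φ x ^ 2 := by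
    intro i
    rw [← integral_const_mul, ← integral_const_mul, ← integral_add (hint _ (by fun_prop))
      (hint _ (by have := hpc i; fun_prop))]
    refine setIntegral_mono_on (hint _ (contDiff_pd (hψ i) i).continuous)
      (hint _ (by have := hpc i; fun_prop)) (isCompact_hull K.1).measurableSet ?_
    intro x hx
    rw [pd_mul hφ2 (hcoord i), pd_mul hφ hφ, hpdc]
    have hd : ‖x - x₀‖ ≤ size K.1 := by
      rw [← dist_eq_norm]; exact hull_subset_closedBall K hx₀ hx
    have hc : |(x - x₀) i| ≤ size K.1 := by
      have := PiLp.norm_apply_le (x - x₀) i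
      rw [Real.norm_eq_abs] at this
      linarith
    have h1 : (x - x₀) i ^ 2 ≤ size K.1 ^ 2 := by
      rw [← sq_abs]
      gcongr
    nlinarith [sq_nonneg (φ x - pd i φ x * (x - x₀) i), mul_le_mul_of_nonneg_left h1
      (sq_nonneg (pd i φ x))]
  refine (Finset.sum_le_sum fun i _ => e2 i).trans (le_of_eq ?_)
  rw [Finset.sum_add_distrib, Finset.sum_const, ← Finset.mul_sum]
  simp
  ring

end Cells

/-! ### Traces on the boundary of a cell -/

variable {T}

theorem memLp_hull_of_continuous {f : E (m + 1) → ℝ} (hf : Continuous f) (K : T.Cell) :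
    MemLp f 2 (volume.restrict (hull K.1)) :=
  memLp_of_continuous hf (isCompact_hull _)

/-- The trace inequality on a cell. -/
theorem IsCellTrace.trace_inequality {K : T.Cell} {v g : E (m + 1) → ℝ}
    {G : Fin (m + 1) → E (m + 1) → ℝ} (h : T.IsCellTrace K v G g)
    (hv : MemLp v 2 (volume.restrict (hull K.1)))
    (hG : ∀ i, MemLp (G i) 2 (volume.restrict (hull K.1)))
    {x₀ : E (m + 1)} {r : ℝ} (hr : 0 ≤ r) (hb : Metric.closedBall x₀ r ⊆ hull K.1) :
    r * ∑ F ∈ T.facetsOf K, ∫ x, g x ^ 2 ∂(surf F.1)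
      ≤ 2 * (m + 1) * (∫ x in hull K.1, v x ^ 2)
        + size K.1 ^ 2 * ∑ i, ∫ x in hull K.1, G i x ^ 2 := by
  obtain ⟨hg, φ, hφ, h1, h2, h3⟩ := h
  refine le_of_tendsto_of_tendsto'
    (f := fun n => r * ∑ F ∈ T.facetsOf K, ∫ x, φ n x ^ 2 ∂(surf F.1))
    (g := fun n => 2 * (m + 1) * (∫ x in hull K.1, φ n x ^ 2)
        + size K.1 ^ 2 * ∑ i, ∫ x in hull K.1, pd i (φ n) x ^ 2) (b := atTop) ?_ ?_
    fun n => trace_inequality_smooth K hr hb (hφ n)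
  · refine (tendsto_finsetSum _ fun F hF => ?_).const_mul _
    exact tendsto_integral_sq (hg F hF) (fun n => memLp_surf_of_continuous (hφ n).continuous F)
      (h3 F hF)
  · refine Tendsto.add (Tendsto.const_mul _ ?_)
      ((tendsto_finsetSum _ fun i _ => ?_).const_mul _)
    · exact tendsto_integral_sq hv (fun n => memLp_hull_of_continuous (hφ n).continuous K) h1
    · exact tendsto_integral_sq (hG i)
        (fun n => memLp_hull_of_continuous (contDiff_pd (hφ n) i).continuous K) (h2 i)

/-- Green's formula on a cell. -/
theorem IsCellTrace.green {K : T.Cell} {v g : E (m + 1) → ℝ}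
    {G : Fin (m + 1) → E (m + 1) → ℝ} (h : T.IsCellTrace K v G g)
    (hv : MemLp v 2 (volume.restrict (hull K.1)))
    (hG : ∀ i, MemLp (G i) 2 (volume.restrict (hull K.1)))
    {w : E (m + 1) → ℝ} (hw : ContDiff ℝ ∞ w) (i : Fin (m + 1)) :
    (∫ x in hull K.1, G i x * w x) + ∫ x in hull K.1, v x * pd i w x
      = ∑ F ∈ T.facetsOf K, normal K.1 F.1 i * ∫ x, g x * w x ∂(surf F.1) := by
  obtain ⟨hg, φ, hφ, h1, h2, h3⟩ := h
  have hwc := hw.continuous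
  have hwi := (contDiff_pd hw i).continuous
  refine tendsto_nhds_unique (f := fun n => (∫ x in hull K.1, pd i (φ n) x * w x)
    + ∫ x in hull K.1, φ n x * pd i w x) (l := atTop) ?_ ?_
  · refine Tendsto.add ?_ ?_
    · exact tendsto_integral_mul_const (hG i)
        (fun n => memLp_hull_of_continuous (contDiff_pd (hφ n) i).continuous K) (h2 i)
        (memLp_hull_of_continuous hwc K)
    · exact tendsto_integral_mul_const hv
        (fun n => memLp_hull_of_continuous (hφ n).continuous K) h1
        (memLp_hull_of_continuous hwi K)
  · have e : ∀ n, (∫ x in hull K.1, pd i (φ n) x * w x) + ∫ x in hull K.1, φ n x * pd i w x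
        = ∑ F ∈ T.facetsOf K, normal K.1 F.1 i * ∫ x, φ n x * w x ∂(surf F.1) := by
      intro n
      have hc1 := (hφ n).continuous
      have hc2 := (contDiff_pd (hφ n) i).continuous
      rw [← setIntegral_cell_pd K ((hφ n).mul hw) i, ← integral_add]
      · congr 1
        funext x
        rw [pd_mul (hφ n) hw]
      · exact (hc2.mul hwc).continuousOn.integrableOn_compact (isCompact_hull K.1)
      · exact (hc1.mul hwi).continuousOn.integrableOn_compact (isCompact_hull K.1)
    simp only [e]
    refine tendsto_finsetSum _ fun F hF => Tendsto.const_mul _ ?_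
    exact tendsto_integral_mul_const (hg F hF)
      (fun n => memLp_surf_of_continuous (hφ n).continuous F) (h3 F hF)
      (memLp_surf_of_continuous hwc F)

theorem IsCellTrace.add {K : T.Cell} {v g v' g' : E (m + 1) → ℝ}
    {G G' : Fin (m + 1) → E (m + 1) → ℝ} (h : T.IsCellTrace K v G g) (h' : T.IsCellTrace K v' G' g')
    (hv : MemLp v 2 (volume.restrict (hull K.1)))
    (hG : ∀ i, MemLp (G i) 2 (volume.restrict (hull K.1)))
    (hv' : MemLp v' 2 (volume.restrict (hull K.1)))
    (hG' : ∀ i, MemLp (G' i) 2 (volume.restrict (hull K.1))) :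
    T.IsCellTrace K (fun x => v x + v' x) (fun i x => G i x + G' i x) (fun x => g x + g' x) := by
  obtain ⟨hg, φ, hφ, h1, h2, h3⟩ := h
  obtain ⟨hg', φ', hφ', h1', h2', h3'⟩ := h'
  have hc := fun n => (hφ n).continuous
  have hc' := fun n => (hφ' n).continuous
  refine ⟨fun F hF => (hg F hF).add (hg' F hF), fun n x => φ n x + φ' n x,
    fun n => (hφ n).add (hφ' n), ?_, fun i => ?_, fun F hF => ?_⟩
  · exact tendsto_eLpNorm_sub_add
      (fun n => (hc n).aestronglyMeasurable.sub hv.aestronglyMeasurable)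
      (fun n => (hc' n).aestronglyMeasurable.sub hv'.aestronglyMeasurable) h1 h1'
  · simp only [pd_add (hφ _) (hφ' _)]
    exact tendsto_eLpNorm_sub_add
      (fun n => (contDiff_pd (hφ n) i).continuous.aestronglyMeasurable.sub
        (hG i).aestronglyMeasurable)
      (fun n => (contDiff_pd (hφ' n) i).continuous.aestronglyMeasurable.sub
        (hG' i).aestronglyMeasurable) (h2 i) (h2' i)
  · exact tendsto_eLpNorm_sub_add
      (fun n => (hc n).aestronglyMeasurable.sub (hg F hF).aestronglyMeasurable)
      (fun n => (hc' n).aestronglyMeasurable.sub (hg' F hF).aestronglyMeasurable)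
      (h3 F hF) (h3' F hF)

theorem IsCellTrace.neg {K : T.Cell} {v g : E (m + 1) → ℝ}
    {G : Fin (m + 1) → E (m + 1) → ℝ} (h : T.IsCellTrace K v G g) :
    T.IsCellTrace K (fun x => -v x) (fun i x => -G i x) (fun x => -g x) := by
  obtain ⟨hg, φ, hφ, h1, h2, h3⟩ := h
  refine ⟨fun F hF => (hg F hF).neg, fun n x => -φ n x, fun n => (hφ n).neg,
    tendsto_eLpNorm_sub_neg h1, fun i => ?_, fun F hF => tendsto_eLpNorm_sub_neg (h3 F hF)⟩
  simp only [pd_neg]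
  exact tendsto_eLpNorm_sub_neg (h2 i)

theorem isCellTrace_ev (K : T.Cell) (p : MvPolynomial (Fin (m + 1)) ℝ) :
    T.IsCellTrace K (ev p) (fun i => ev (MvPolynomial.pderiv i p)) (ev p) := by
  refine ⟨fun F _ => memLp_surf_of_continuous (continuous_ev p) F, fun _ => ev p,
    fun _ => contDiff_ev p, by simp, fun i => ?_, by simp⟩
  simp [pd_ev]

/-! ### Geometry of the mesh: shared facets, opposite normals, cancellation. -/

theorem hull_subset_closure (K : T.Cell) : hull K.1 ⊆ closure Ω := by
  rw [← T.space_eq]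
  exact T.complex.convexHull_subset_space (cell_mem_faces K)

/-- The interior of a cell lies in the interior of the closure of Ω, which is Ω itself, and the
frontier of a convex set is null. Integrability on Ω thus passes to cells. -/
theorem hull_ae_le (hΩ : IsDomain Ω) (K : T.Cell) : hull K.1 ≤ᵐ[volume] Ω := by
  have h1 : volume (frontier (hull K.1)) = 0 := (convex_hull K.1).addHaar_frontier volume
  have h2 : interior (hull K.1) ⊆ Ω :=
    (interior_mono (hull_subset_closure K)).trans hΩ.interior_closure.subset
  have h3 : ∀ᵐ x ∂(volume : Measure (E (m + 1))), x ∉ frontier (hull K.1) :=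
    measure_eq_zero_iff_ae_notMem.1 h1
  filter_upwards [h3] with x hx hxK
  apply h2
  by_contra hxi
  apply hx
  rw [(isCompact_hull K.1).isClosed.frontier_eq]
  exact ⟨hxK, hxi⟩

theorem exists_cell_of_mem_closure {z : E (m + 1)} (hz : z ∈ closure Ω) :
    ∃ K : T.Cell, z ∈ hull K.1 := by
  rw [← T.space_eq, Geometry.SimplicialComplex.mem_space_iff] at hz
  obtain ⟨s, hs, hzs⟩ := hz
  obtain ⟨t, ht, hst, hc⟩ := T.pure s hs
  exact ⟨⟨t, Finset.mem_filter.2 ⟨T.finite.mem_toFinset.2 ht, hc⟩⟩, hull_mono hst hzs⟩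

/-- The affine basis formed by the vertices of a cell. -/
def cellBasis (K : T.Cell) : AffineBasis K.1 ℝ (E (m + 1)) where
  toFun := (↑)
  ind' := cell_indep K
  tot' := (cell_indep K).affineSpan_eq_top_iff_card_eq_finrank_add_one.2 (by simp [cell_card K])

@[simp]
theorem cellBasis_apply (K : T.Cell) (p : K.1) : cellBasis K p = p := rfl

theorem hull_eq_nonneg_coord (K : T.Cell) :
    hull K.1 = {x | ∀ p, 0 ≤ (cellBasis K).coord p x} := by
  rw [← AffineBasis.convexHull_eq_nonneg_coord, hull]
  congr 1
  exact Subtype.range_coe.symm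

/-- The relative interior of a simplex. -/
def openSimplex {d : ℕ} (F : Finset (E d)) : Set (E d) :=
  {x | ∃ w : E d → ℝ, (∀ f ∈ F, 0 < w f) ∧ ∑ f ∈ F, w f = 1 ∧ ∑ f ∈ F, w f • f = x}

theorem openSimplex_subset_hull {d : ℕ} (F : Finset (E d)) : openSimplex F ⊆ hull F := by
  rintro x ⟨w, h0, h1, rfl⟩
  exact Finset.mem_convexHull'.2 ⟨w, fun f hf => (h0 f hf).le, h1, rfl⟩

theorem hull_subset_closure_openSimplex {d : ℕ} {F : Finset (E d)} (hF : F.Nonempty) :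
    hull F ⊆ closure (openSimplex F) := by
  intro y hy
  obtain ⟨w, h0, h1, rfl⟩ := Finset.mem_convexHull'.1 hy
  have hcard : (0 : ℝ) < F.card := by exact_mod_cast hF.card_pos
  -- Moving the point slightly towards the barycentre makes all weights positive.
  let c : ℝ → E d := fun t => ∑ f ∈ F, ((1 - t) * w f + t * (F.card : ℝ)⁻¹) • f
  have hc : Continuous c := by fun_prop
  have hc0 : c 0 = ∑ f ∈ F, w f • f := by simp [c]
  rw [← hc0]
  have hlim : Tendsto c (𝓝[>] 0) (𝓝 (c 0)) := hc.continuousAt.tendsto.mono_left nhdsWithin_le_nhds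
  refine mem_closure_of_tendsto hlim ?_
  filter_upwards [Ioo_mem_nhdsGT (zero_lt_one (α := ℝ))] with t ht
  refine ⟨fun f => (1 - t) * w f + t * (F.card : ℝ)⁻¹, fun f hf => ?_, ?_, rfl⟩
  · have := h0 f hf
    have h2 : 0 < t * (F.card : ℝ)⁻¹ := mul_pos ht.1 (inv_pos.2 hcard)
    have h3 : 0 ≤ (1 - t) * w f := mul_nonneg (by linarith [ht.2]) this
    linarith
  · rw [Finset.sum_add_distrib, ← Finset.mul_sum, h1, Finset.sum_const, nsmul_eq_mul]
    field_simp
    ring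

theorem affineMap_sum_smul {d : ℕ} (g : E d →ᵃ[ℝ] ℝ) {F : Finset (E d)} {w : E d → ℝ}
    (h1 : ∑ f ∈ F, w f = 1) : g (∑ f ∈ F, w f • f) = ∑ f ∈ F, w f * g f := by
  have h : ∀ x, g x = g.linear x + g 0 := fun x => congrFun g.decomp x
  have h2 : ∀ f, w f * g f = w f * g.linear f + w f * g 0 := fun f => by rw [← mul_add, ← h f]
  rw [h, map_sum, Finset.sum_congr rfl fun f _ => h2 f, Finset.sum_add_distrib, ← Finset.sum_mul,
    h1, one_mul]
  simp

theorem coord_cellBasis (K : T.Cell) (p : K.1) {f : E (m + 1)} (hf : f ∈ K.1) :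
    (cellBasis K).coord p f = if f = p then 1 else 0 := by
  have h := (cellBasis K).coord_apply p ⟨f, hf⟩
  rw [cellBasis_apply] at h
  rw [h]
  by_cases hfp : f = p
  · rw [if_pos hfp, if_pos (Subtype.ext hfp.symm)]
  · rw [if_neg hfp, if_neg (fun h => hfp (congrArg Subtype.val h).symm)]

theorem coord_sum (K : T.Cell) (p : K.1) {F : Finset (E (m + 1))} (hF : F ⊆ K.1)
    {w : E (m + 1) → ℝ} (h1 : ∑ f ∈ F, w f = 1) :
    (cellBasis K).coord p (∑ f ∈ F, w f • f) = if (p : E (m + 1)) ∈ F then w p else 0 := by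
  rw [affineMap_sum_smul _ h1, ← Finset.sum_ite_eq' F (p : E (m + 1)) w]
  refine Finset.sum_congr rfl fun f hf => ?_
  rw [coord_cellBasis K p (hF hf)]
  simp

/-- By conformity the point is a convex combination of the common vertices of F and K'. If a vertex
f of F were missing from K', the barycentric coordinate of f, computed in a cell K containing F,
would vanish there; but it is positive in the relative interior of F. -/
theorem facet_subset_of_mem_hull {F : T.Facet} {K' : T.Cell} {x : E (m + 1)}
    (hx : x ∈ openSimplex F.1) (hxK : x ∈ hull K'.1) : F ∈ T.facetsOf K' := by
  obtain ⟨K, hK⟩ := exists_cell_of_facet F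
  rw [mem_facetsOf] at hK ⊢
  by_contra hsub
  obtain ⟨f, hfF, hfK'⟩ := Finset.not_subset.1 hsub
  have h1 := T.complex.inter_subset_convexHull (cell_mem_faces K') (facet_mem_faces F)
    ⟨hxK, openSimplex_subset_hull _ hx⟩
  rw [← Finset.coe_inter] at h1
  obtain ⟨w', -, h1', hw'⟩ := Finset.mem_convexHull'.1 h1
  obtain ⟨w, h0, h2, hw⟩ := hx
  have e1 := coord_sum K ⟨f, hK hfF⟩ hK h2
  have e2 := coord_sum K ⟨f, hK hfF⟩ (Finset.inter_subset_right.trans hK) h1'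
  rw [hw, if_pos hfF] at e1
  rw [hw', e1, if_neg (fun h => hfK' (Finset.mem_inter.1 h).1)] at e2
  exact (h0 f hfF).ne' e2

/-- A vector which is orthogonal to a facet sees only the barycentric coordinate of the opposite
vertex. -/
theorem inner_sub_eq_coord {K : T.Cell} {F : T.Facet} {q : E (m + 1)} (hq : q ∈ K.1)
    (hF : F.1 = K.1.erase q) {u x : E (m + 1)} (hu : ∀ y ∈ F.1, inner ℝ u (y - x) = 0)
    (z : E (m + 1)) :
    inner ℝ u (z - x) = (cellBasis K).coord ⟨q, hq⟩ z * inner ℝ u (q - x) := by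
  have h1 := (cellBasis K).linear_combination_coord_eq_self z
  have h2 := (cellBasis K).sum_coord_apply_eq_one z
  have h3 : z - x = ∑ p : K.1, (cellBasis K).coord p z • ((p : E (m + 1)) - x) := by
    simp only [smul_sub, Finset.sum_sub_distrib, ← Finset.sum_smul, h2, one_smul]
    congr 1
    exact h1.symm
  conv_lhs => rw [h3, inner_sum]
  rw [Finset.sum_eq_single (⟨q, hq⟩ : K.1)]
  · rw [real_inner_smul_right]
  · intro p _ hp
    rw [real_inner_smul_right, hu p, mul_zero]
    rw [hF]
    exact Finset.mem_erase.2 ⟨fun h => hp (Subtype.ext h), p.2⟩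
  · intro h
    exact absurd (Finset.mem_univ _) h

theorem inner_normal_eq_zero {K : T.Cell} {F : T.Facet} (hK : F ∈ T.facetsOf K) {x y : E (m + 1)}
    (hx : x ∈ hull F.1) (hy : y ∈ hull F.1) : inner ℝ (normal K.1 F.1) (y - x) = 0 := by
  obtain ⟨f, hf⟩ := facet_nonempty F
  have h2 := (isOutwardNormal_normal hK).2.1
  have e1 := inner_eq_of_mem_hull (fun z hz => h2 z hz f hf) hx
  have e2 := inner_eq_of_mem_hull (fun z hz => h2 z hz f hf) hy
  rw [← sub_sub_sub_cancel_right y x f, inner_sub_right, e1, e2, sub_zero]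

/-- Near a relatively interior point of a facet, a cell is a half space. -/
theorem eventually_mem_hull {K : T.Cell} {F : T.Facet} (hK : F ∈ T.facetsOf K) {x : E (m + 1)}
    (hx : x ∈ openSimplex F.1) :
    ∀ᶠ z in 𝓝 x, inner ℝ (normal K.1 F.1) (z - x) ≤ 0 → z ∈ hull K.1 := by
  obtain ⟨q, hq, hF⟩ := exists_facet_eq_erase hK
  have hxh := openSimplex_subset_hull _ hx
  have hn := isOutwardNormal_normal hK
  have hq0 : inner ℝ (normal K.1 F.1) (q - x) < 0 := by
    obtain ⟨f, hf⟩ := facet_nonempty F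
    have h1 := hn.2.2 f hf q hq (by rw [hF]; simp)
    have h2 := inner_normal_eq_zero hK hxh (subset_hull hf)
    rw [← sub_add_sub_cancel q f x, inner_add_right]
    linarith
  -- The coordinates of the vertices of F are positive at x, hence also nearby. The remaining
  -- coordinate, that of q, has the sign opposite to the normal component of z - x.
  have hpos : ∀ p : K.1, (p : E (m + 1)) ∈ F.1 → ∀ᶠ z in 𝓝 x, 0 < (cellBasis K).coord p z := by
    intro p hp
    obtain ⟨w, h0, h1, rfl⟩ := hx
    have hc : Continuous ((cellBasis K).coord p) := AffineMap.continuous_of_finiteDimensional _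
    refine hc.continuousAt.eventually (lt_mem_nhds ?_)
    rw [coord_sum K p (mem_facetsOf.1 hK) h1, if_pos hp]
    exact h0 p hp
  have hall : ∀ᶠ z in 𝓝 x, ∀ p : K.1, (p : E (m + 1)) ∈ F.1 → 0 < (cellBasis K).coord p z :=
    eventually_all.2 fun p => by
      by_cases hp : (p : E (m + 1)) ∈ F.1
      · exact (hpos p hp).mono fun z hz _ => hz
      · exact Eventually.of_forall fun z h => absurd h hp
  filter_upwards [hall] with z hz hzn
  rw [hull_eq_nonneg_coord]
  intro p
  by_cases hp : (p : E (m + 1)) ∈ F.1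
  · exact (hz p hp).le
  · have hpq : p = ⟨q, hq⟩ := by
      apply Subtype.ext
      by_contra h
      exact hp (by rw [hF]; exact Finset.mem_erase.2 ⟨h, p.2⟩)
    subst hpq
    have h1 := inner_sub_eq_coord hq hF (u := normal K.1 F.1) (x := x)
      (fun y hy => inner_normal_eq_zero hK hxh (subset_hull hy)) z
    by_contra hneg
    push Not at hneg
    have := mul_pos_of_neg_of_neg hneg hq0
    linarith

theorem exists_mem_openSimplex (F : T.Facet) : ∃ x, x ∈ openSimplex F.1 := by
  have hne : (closure (openSimplex F.1)).Nonempty := by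
    obtain ⟨f, hf⟩ := facet_nonempty F
    exact ⟨f, hull_subset_closure_openSimplex ⟨f, hf⟩ (subset_hull hf)⟩
  exact closure_nonempty_iff.1 hne

theorem eventually_add_smul {x n : E (m + 1)} {p : E (m + 1) → Prop} (h : ∀ᶠ z in 𝓝 x, p z) :
    ∀ᶠ ε in 𝓝[>] (0 : ℝ), p (x + ε • n) := by
  have hc : Continuous (fun ε : ℝ => x + ε • n) := by fun_prop
  have h1 : Tendsto (fun ε : ℝ => x + ε • n) (𝓝[>] 0) (𝓝 x) := by
    have := hc.tendsto 0
    rw [zero_smul, add_zero] at this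
    exact this.mono_left nhdsWithin_le_nhds
  exact h1.eventually h

/-- The outward normals of two different cells on a common facet are opposite. -/
theorem normal_eq_neg {K K' : T.Cell} (hne : K ≠ K') {F : T.Facet} (hK : F ∈ T.facetsOf K)
    (hK' : F ∈ T.facetsOf K') : normal K'.1 F.1 = -normal K.1 F.1 := by
  obtain ⟨x, hx⟩ := exists_mem_openSimplex F
  have hxh := openSimplex_subset_hull _ hx
  set n := normal K.1 F.1 with hndef
  set n' := normal K'.1 F.1 with hndef'
  have hn1 : ‖n‖ = 1 := (isOutwardNormal_normal hK).1
  have hn1' : ‖n'‖ = 1 := (isOutwardNormal_normal hK').1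
  -- Both normals are orthogonal to F, so as functionals both are multiples of the same barycentric
  -- coordinate; being unit vectors, they agree up to sign.
  have hpar : n' = n ∨ n' = -n := by
    obtain ⟨q, hq, hF⟩ := exists_facet_eq_erase hK
    have e1 := inner_sub_eq_coord hq hF (u := n) (x := x)
      (fun y hy => inner_normal_eq_zero hK hxh (subset_hull hy))
    have e2 := inner_sub_eq_coord hq hF (u := n') (x := x)
      (fun y hy => inner_normal_eq_zero hK' hxh (subset_hull hy))
    have hq0 : inner ℝ n (q - x) ≠ 0 := by
      intro h
      have h1 := e1 (x + n)
      rw [h, mul_zero, add_sub_cancel_left, real_inner_self_eq_norm_sq, hn1] at h1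
      norm_num at h1
    have hlam : n' = (inner ℝ n' (q - x) / inner ℝ n (q - x)) • n := by
      refine ext_inner_right ℝ fun v => ?_
      have h1 := e1 (x + v)
      have h2 := e2 (x + v)
      rw [add_sub_cancel_left] at h1 h2
      rw [real_inner_smul_left, h1, h2]
      field_simp
    set lam := inner ℝ n' (q - x) / inner ℝ n (q - x)
    have h3 : |lam| = 1 := by
      have := congrArg norm hlam
      rw [norm_smul, hn1, hn1', Real.norm_eq_abs, mul_one] at this
      exact this.symm
    rcases eq_or_eq_neg_of_abs_eq h3 with h | h
    · left
      rw [hlam, h, one_smul]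
    · right
      rw [hlam, h, neg_smul, one_smul]
  rcases hpar with h | h
  · exfalso
    -- Equal normals would put x - εn in both cells for small ε. Two distinct cells sharing F meet
    -- only in F, by conformity, while this point is off the hyperplane of F.
    have ev1 := eventually_add_smul (n := -n) (eventually_mem_hull hK hx)
    have ev2 := eventually_add_smul (n := -n) (eventually_mem_hull hK' hx)
    obtain ⟨ε, h1, h2, hε⟩ := (ev1.and (ev2.and self_mem_nhdsWithin)).exists
    have hε0 : (0 : ℝ) < ε := hε
    have hval : inner ℝ n (x + ε • -n - x) = -ε := by
      rw [add_sub_cancel_left, real_inner_smul_right, inner_neg_right,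
        real_inner_self_eq_norm_sq, hn1]
      ring
    have m1 := h1 (by rw [← hndef, hval]; linarith)
    have m2 := h2 (by rw [← hndef', h, hval]; linarith)
    have m3 := T.complex.inter_subset_convexHull (cell_mem_faces K) (cell_mem_faces K') ⟨m1, m2⟩
    have hFi : K.1 ∩ K'.1 = F.1 := by
      symm
      apply Finset.eq_of_subset_of_card_le
        (Finset.subset_inter (mem_facetsOf.1 hK) (mem_facetsOf.1 hK'))
      rw [facet_card F]
      by_contra hlt
      push Not at hlt
      have i1 : K.1 ∩ K'.1 = K.1 :=
        Finset.eq_of_subset_of_card_le Finset.inter_subset_left (by rw [cell_card]; omega)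
      have i2 : K.1 ∩ K'.1 = K'.1 :=
        Finset.eq_of_subset_of_card_le Finset.inter_subset_right (by rw [cell_card]; omega)
      exact hne (Subtype.ext (i1.symm.trans i2))
    rw [← Finset.coe_inter, hFi] at m3
    have := inner_normal_eq_zero hK hxh m3
    rw [← hndef, hval] at this
    linarith
  · exact h

/-- A facet which does not lie on the boundary of the domain has cells on both sides. -/
theorem exists_other_cell (hΩ : IsDomain Ω) {F : T.Facet} (hF : ¬ hull F.1 ⊆ frontier Ω)
    {K : T.Cell} (hK : F ∈ T.facetsOf K) : ∃ K' : T.Cell, K ≠ K' ∧ F ∈ T.facetsOf K' := by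
  obtain ⟨y, hy, hyf⟩ := Set.not_subset.1 hF
  have hyΩ : y ∈ Ω := by
    by_contra h
    apply hyf
    rw [frontier, hΩ.isOpen.interior_eq]
    exact ⟨hull_subset_closure K (hull_mono (mem_facetsOf.1 hK) hy), h⟩
  -- Since Ω is open and the relative interior is dense in the facet, the point in Ω may be taken
  -- relatively interior.
  obtain ⟨x, hxΩ, hx⟩ := mem_closure_iff.1
    (hull_subset_closure_openSimplex (facet_nonempty F) hy) Ω hΩ.isOpen hyΩ
  have hxh := openSimplex_subset_hull _ hx
  -- Cells are closed and finite in number, so near x only cells through x occur, and these contain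
  -- all of F.
  have ev1 : ∀ᶠ z in 𝓝 x, ∀ K' : T.Cell, z ∈ hull K'.1 → F ∈ T.facetsOf K' := by
    refine eventually_all.2 fun K' => ?_
    by_cases h : x ∈ hull K'.1
    · exact Eventually.of_forall fun z _ => facet_subset_of_mem_hull hx h
    · filter_upwards [(isCompact_hull K'.1).isClosed.isOpen_compl.mem_nhds h] with z hz hz'
      exact absurd hz' hz
  have ev2 : ∀ᶠ z in 𝓝 x, z ∈ Ω := hΩ.isOpen.mem_nhds hxΩ
  -- The point x + εn is outside K but still in Ω, so another cell covers it.
  obtain ⟨ε, ⟨h1, h2⟩, hε⟩ := ((eventually_add_smul (n := normal K.1 F.1)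
    (ev1.and ev2)).and self_mem_nhdsWithin).exists
  have hε0 : (0 : ℝ) < ε := hε
  obtain ⟨K', hK'⟩ := exists_cell_of_mem_closure (T := T) (subset_closure h2)
  refine ⟨K', ?_, h1 K' hK'⟩
  rintro rfl
  obtain ⟨hn1, hn2, hn3⟩ := isOutwardNormal_normal hK
  have hle : inner ℝ (normal K.1 F.1) (x + ε • normal K.1 F.1 - x) ≤ 0 := by
    refine inner_le_of_mem_hull (F := K.1) (fun p hp => ?_) hK'
    obtain ⟨f, hf⟩ := facet_nonempty F
    have e1 := inner_normal_eq_zero hK hxh (subset_hull hf)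
    rw [← sub_add_sub_cancel p f x, inner_add_right, e1, add_zero]
    by_cases hpF : p ∈ F.1
    · exact (hn2 p hpF f hf).le
    · exact (hn3 f hf p hp hpF).le
  rw [add_sub_cancel_left, real_inner_smul_right, real_inner_self_eq_norm_sq, hn1] at hle
  linarith

/-- Single-valued facet terms which vanish on the boundary of the domain cancel when summed over
the boundaries of all cells. -/
theorem sum_normal_mul_eq_zero (hΩ : IsDomain Ω) (i : Fin (m + 1)) (a : T.Facet → ℝ)
    (ha : ∀ F : T.Facet, hull F.1 ⊆ frontier Ω → a F = 0) :
    ∑ K : T.Cell, ∑ F ∈ T.facetsOf K, normal K.1 F.1 i * a F = 0 := by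
  classical
  have e1 : ∑ K : T.Cell, ∑ F ∈ T.facetsOf K, normal K.1 F.1 i * a F
      = ∑ F : T.Facet, ∑ K : T.Cell with F ∈ T.facetsOf K, normal K.1 F.1 i * a F := by
    apply Finset.sum_comm'
    simp
  rw [e1]
  refine Finset.sum_eq_zero fun F _ => ?_
  by_cases hF : hull F.1 ⊆ frontier Ω
  · simp [ha F hF]
  · obtain ⟨K, hK⟩ := exists_cell_of_facet F
    obtain ⟨K', hne, hK'⟩ := exists_other_cell hΩ hF hK
    -- A third cell is impossible: three pairwise opposite normals would all be zero.
    have hset : (Finset.univ.filter fun K : T.Cell => F ∈ T.facetsOf K) = {K, K'} := by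
      ext K''
      simp only [Finset.mem_filter, Finset.mem_univ, true_and, Finset.mem_insert,
        Finset.mem_singleton]
      constructor
      · intro h
        by_contra hcon
        push Not at hcon
        have e1 := normal_eq_neg hne hK hK'
        have e2 := normal_eq_neg hcon.1 h hK
        have e3 := normal_eq_neg hcon.2 h hK'
        have h0 : normal K.1 F.1 = 0 := by
          rw [e3, e2] at e1
          have e4 : normal K''.1 F.1 = 0 := by
            have : normal K''.1 F.1 = -normal K''.1 F.1 := by
              rw [neg_neg] at e1
              exact e1.symm
            rwa [eq_neg_iff_add_eq_zero, ← two_smul ℝ, smul_eq_zero_iff_right two_ne_zero] at this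
          rw [e2, e4, neg_zero]
        have h1 := (isOutwardNormal_normal hK).1
        rw [h0, norm_zero] at h1
        exact zero_ne_one h1
      · rintro (rfl | rfl)
        · exact hK
        · exact hK'
    rw [hset, Finset.sum_pair hne, normal_eq_neg hne hK hK']
    simp

end Triangulation

/-! ### Weighted forms of the Cauchy-Schwarz and triangle inequalities -/

/-- The right-hand side is minimised at t = b/a, with value ab; shifting a and b by δ covers zero
values. Bounds with a common t can be summed over components, facets and cells, so one application
replaces nested Cauchy-Schwarz inequalities. -/
theorem le_mul_of_forall_weighted {x a b : ℝ} (ha : 0 ≤ a) (hb : 0 ≤ b)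
    (h : ∀ t : ℝ, 0 < t → x ≤ t / 2 * a ^ 2 + 1 / (2 * t) * b ^ 2) : x ≤ a * b := by
  have hlim : Tendsto (fun δ : ℝ => (a + δ) * (b + δ)) (𝓝[>] 0) (𝓝 (a * b)) := by
    have hc : Continuous (fun δ : ℝ => (a + δ) * (b + δ)) := by fun_prop
    have := (hc.tendsto 0).mono_left (nhdsWithin_le_nhds (s := Ioi 0))
    simpa using this
  refine ge_of_tendsto hlim ?_
  filter_upwards [self_mem_nhdsWithin] with δ hδ
  have hδ0 : (0 : ℝ) < δ := hδ
  have h1 : 0 < a + δ := by linarith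
  have h2 : 0 < b + δ := by linarith
  have h3 := h ((b + δ) / (a + δ)) (by positivity)
  have h4 : (b + δ) / (a + δ) / 2 * a ^ 2 ≤ (b + δ) / (a + δ) / 2 * (a + δ) ^ 2 := by
    gcongr
    linarith
  have h5 : 1 / (2 * ((b + δ) / (a + δ))) * b ^ 2
      ≤ 1 / (2 * ((b + δ) / (a + δ))) * (b + δ) ^ 2 := by
    gcongr
    linarith
  refine h3.trans ((add_le_add h4 h5).trans (le_of_eq ?_))
  field_simp
  ring

/-- The infimum over t of the right-hand side is (a + b)². It yields the triangle inequality for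
`normD` from cellwise bounds with a common t. -/
theorem le_add_of_forall_weighted {x a b : ℝ} (ha : 0 ≤ a) (hb : 0 ≤ b)
    (h : ∀ t : ℝ, 0 < t → x ^ 2 ≤ (1 + t) * a ^ 2 + (1 + 1 / t) * b ^ 2) : x ≤ a + b := by
  have h1 : (x ^ 2 - a ^ 2 - b ^ 2) / 2 ≤ a * b := by
    refine le_mul_of_forall_weighted ha hb fun t ht => ?_
    have h2 := h t ht
    have h3 : 1 / (2 * t) * b ^ 2 = 1 / t * b ^ 2 / 2 := by
      field_simp
    rw [h3]
    linarith
  refine le_of_sq_le_sq ?_ (by positivity)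
  nlinarith

section Integrals

variable {X : Type*} [MeasurableSpace X] {μ : Measure X}

theorem integrable_mul_of_memLp {f g : X → ℝ} (hf : MemLp f 2 μ) (hg : MemLp g 2 μ) :
    Integrable (fun x => f x * g x) μ :=
  hf.integrable_mul hg

theorem abs_integral_mul_le {f g : X → ℝ} (hf : MemLp f 2 μ) (hg : MemLp g 2 μ) {t : ℝ}
    (ht : 0 < t) :
    |∫ x, f x * g x ∂μ| ≤ t / 2 * (∫ x, f x ^ 2 ∂μ) + 1 / (2 * t) * ∫ x, g x ^ 2 ∂μ := by
  rw [← integral_const_mul, ← integral_const_mul,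
    ← integral_add (hf.integrable_sq.const_mul _) (hg.integrable_sq.const_mul _)]
  refine abs_integral_le_integral_abs.trans (integral_mono (integrable_mul_of_memLp hf hg).abs
    ((hf.integrable_sq.const_mul _).add (hg.integrable_sq.const_mul _)) fun x => ?_)
  have e : t / 2 * f x ^ 2 + 1 / (2 * t) * g x ^ 2 - |f x| * |g x|
      = 1 / (2 * t) * (t * |f x| - |g x|) ^ 2 := by
    rw [← sq_abs (f x), ← sq_abs (g x)]
    field_simp
    ring
  have h : 0 ≤ 1 / (2 * t) * (t * |f x| - |g x|) ^ 2 := by positivity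
  simp only [abs_mul]
  linarith

theorem integral_add_sq_le {f g : X → ℝ} (hf : MemLp f 2 μ) (hg : MemLp g 2 μ) {t : ℝ}
    (ht : 0 < t) :
    ∫ x, (f x + g x) ^ 2 ∂μ ≤ (1 + t) * (∫ x, f x ^ 2 ∂μ) + (1 + 1 / t) * ∫ x, g x ^ 2 ∂μ := by
  rw [← integral_const_mul, ← integral_const_mul,
    ← integral_add (hf.integrable_sq.const_mul _) (hg.integrable_sq.const_mul _)]
  refine integral_mono (hf.add hg).integrable_sq
    ((hf.integrable_sq.const_mul _).add (hg.integrable_sq.const_mul _)) fun x => ?_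
  have e : (1 + t) * f x ^ 2 + (1 + 1 / t) * g x ^ 2 - (f x + g x) ^ 2
      = 1 / t * (t * f x - g x) ^ 2 := by
    field_simp
    ring
  have h : 0 ≤ 1 / t * (t * f x - g x) ^ 2 := by positivity
  dsimp only
  linarith

end Integrals

/-! ### Square-integrability of pairs, their derivatives and their traces. -/

namespace Triangulation

variable {m : ℕ} {Ω : Set (E (m + 1))} {T : Triangulation Ω}

/-- The regularity of a pair which is used in the estimates. -/
structure Pair.Regular (v : T.Pair) : Prop where
  grad : ∀ K i, MemLp (v.grad K i) 2 (volume.restrict (hull K.1))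
  hess : ∀ K i j, MemLp (v.hess K i j) 2 (volume.restrict (hull K.1))
  trace : ∀ K i, T.IsCellTrace K (v.grad K i) (v.hess K i) (v.gradTr K i)
  jump : ∀ K, ∀ F ∈ T.facetsOf K, MemLp (v.jump K F) 2 (surf F.1)

namespace Pair.Regular

variable {v w : T.Pair}

theorem add (hv : v.Regular) (hw : w.Regular) : (v + w).Regular where
  grad K i := (hv.grad K i).add (hw.grad K i)
  hess K i j := (hv.hess K i j).add (hw.hess K i j)
  trace K i := (hv.trace K i).add (hw.trace K i) (hv.grad K i) (hv.hess K i) (hw.grad K i)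
    (hw.hess K i)
  jump K F hF := by
    have h := (hv.jump K F hF).add (hw.jump K F hF)
    convert! h using 1
    funext x
    change (v.bar F x + w.bar F x) - (v.tr K x + w.tr K x) = (v.bar F x - v.tr K x)
      + (w.bar F x - w.tr K x)
    ring

theorem sub (hv : v.Regular) (hw : w.Regular) : (v - w).Regular where
  grad K i := (hv.grad K i).sub (hw.grad K i)
  hess K i j := (hv.hess K i j).sub (hw.hess K i j)
  trace K i := by
    have h := (hv.trace K i).add (hw.trace K i).neg (hv.grad K i) (hv.hess K i) (hw.grad K i).neg
      (fun j => (hw.hess K i j).neg)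
    simp only [← sub_eq_add_neg] at h
    exact h
  jump K F hF := by
    have h := (hv.jump K F hF).sub (hw.jump K F hF)
    convert! h using 1
    funext x
    change (v.bar F x - w.bar F x) - (v.tr K x - w.tr K x) = (v.bar F x - v.tr K x)
      - (w.bar F x - w.tr K x)
    ring

theorem memLp_dn (hv : v.Regular) {K : T.Cell} {F : T.Facet} (hF : F ∈ T.facetsOf K) :
    MemLp (v.dn K F) 2 (surf F.1) := by
  have h := memLp_finsetSum (μ := surf F.1) (p := 2) Finset.univ
    (f := fun i x => v.gradTr K i x * normal K.1 F.1 i)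
    fun i _ => ((hv.trace K i).1 F hF).mul_const _
  exact h

end Pair.Regular

theorem regular_polyPair (p : T.Cell → MvPolynomial (Fin (m + 1)) ℝ)
    (q : T.Facet → MvPolynomial (Fin (m + 1)) ℝ) : (T.polyPair p q).Regular where
  grad K _ := memLp_hull_of_continuous (continuous_ev _) K
  hess K _ _ := memLp_hull_of_continuous (continuous_ev _) K
  trace K _ := isCellTrace_ev K _
  jump K F _ := memLp_surf_of_continuous ((continuous_ev (q F)).sub (continuous_ev (p K))) F

theorem regular_sobolevPair (hΩ : IsDomain Ω) (z z' : T.H2H10) : (T.sobolevPair z z').Regular where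
  grad K i := (z.grad_memLp i).mono_measure (Measure.restrict_mono_ae (hull_ae_le hΩ K))
  hess K i j := (z.hess_memLp i j).mono_measure (Measure.restrict_mono_ae (hull_ae_le hΩ K))
  trace K i := z.isTrace_grad i K
  jump K F hF := ((z'.isTrace K).1 F hF).sub ((z.isTrace K).1 F hF)

theorem regular_of_mem_Wh {k : ℕ} {l : ℝ} {v : T.Pair} (hv : v ∈ T.Wh k l) : v.Regular := by
  obtain ⟨p, q, -, -, -, -, rfl⟩ := hv
  exact regular_polyPair p q

theorem regular_of_mem_Wext (hΩ : IsDomain Ω) {k : ℕ} {l : ℝ} {w : T.Pair}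
    (hw : w ∈ T.Wext k l) : w.Regular := by
  obtain ⟨v, hv, z, z', rfl⟩ := hw
  exact (regular_of_mem_Wh hv).add (regular_sobolevPair hΩ z z')

/-! ### The norms as sums over the cells -/

/-- The square of `‖∇v‖_{0,K}`. -/
def Pair.gradSq (v : T.Pair) (K : T.Cell) : ℝ := ∫ x in hull K.1, ∑ i, v.grad K i x ^ 2

/-- The square of `|v|_{2,K}`. -/
def Pair.hessSq (v : T.Pair) (K : T.Cell) : ℝ := ∫ x in hull K.1, ∑ i, ∑ j, v.hess K i j x ^ 2

/-- The square of `‖v̄ - v‖_{0,∂K}`. -/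
def Pair.jumpSq (v : T.Pair) (K : T.Cell) : ℝ :=
  ∑ F ∈ T.facetsOf K, ∫ x, v.jump K F x ^ 2 ∂(surf F.1)

/-- The square of `‖∇v · n‖_{0,∂K}`. -/
def Pair.dnSq (v : T.Pair) (K : T.Cell) : ℝ :=
  ∑ F ∈ T.facetsOf K, ∫ x, v.dn K F x ^ 2 ∂(surf F.1)

theorem gradSq_nonneg (v : T.Pair) (K : T.Cell) : 0 ≤ v.gradSq K :=
  integral_nonneg fun _ => Finset.sum_nonneg fun _ _ => sq_nonneg _

theorem hessSq_nonneg (v : T.Pair) (K : T.Cell) : 0 ≤ v.hessSq K :=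
  integral_nonneg fun _ => Finset.sum_nonneg fun _ _ => Finset.sum_nonneg fun _ _ => sq_nonneg _

theorem jumpSq_nonneg (v : T.Pair) (K : T.Cell) : 0 ≤ v.jumpSq K :=
  Finset.sum_nonneg fun _ _ => integral_nonneg fun _ => sq_nonneg _

variable {κ α : ℝ}

theorem normD_sq (hκ : 0 < κ) (hα : 0 < α) (v : T.Pair) :
    T.normD κ α v ^ 2 = ∑ K : T.Cell, (κ * v.gradSq K + α * κ / size K.1 * v.jumpSq K) := by
  rw [normD, Real.sq_sqrt, ← Finset.sum_add_distrib]
  · rfl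
  · refine add_nonneg (Finset.sum_nonneg fun K _ => mul_nonneg hκ.le (gradSq_nonneg v K))
      (Finset.sum_nonneg fun K _ => mul_nonneg ?_ (jumpSq_nonneg v K))
    have := size_pos K
    positivity

theorem normD'_sq (hκ : 0 < κ) (hα : 0 < α) (v : T.Pair) :
    T.normD' κ α v ^ 2 = T.normD κ α v ^ 2 + ∑ K : T.Cell, size K.1 ^ 2 * κ / α * v.hessSq K := by
  rw [normD', Real.sq_sqrt]
  · rfl
  · refine add_nonneg (sq_nonneg _)
      (Finset.sum_nonneg fun K _ => mul_nonneg ?_ (hessSq_nonneg v K))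
    positivity

theorem normD_le_normD' (hκ : 0 < κ) (hα : 0 < α) (v : T.Pair) :
    T.normD κ α v ≤ T.normD' κ α v := by
  refine le_of_sq_le_sq ?_ (Real.sqrt_nonneg _)
  rw [normD'_sq hκ hα, le_add_iff_nonneg_right]
  refine Finset.sum_nonneg fun K _ => mul_nonneg ?_ (hessSq_nonneg v K)
  positivity

theorem gradSq_eq {v : T.Pair} (hv : v.Regular) (K : T.Cell) :
    v.gradSq K = ∑ i, ∫ x in hull K.1, v.grad K i x ^ 2 :=
  integral_finsetSum _ fun i _ => (hv.grad K i).integrable_sq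

theorem hessSq_eq {v : T.Pair} (hv : v.Regular) (K : T.Cell) :
    v.hessSq K = ∑ i, ∑ j, ∫ x in hull K.1, v.hess K i j x ^ 2 := by
  rw [Pair.hessSq, integral_finsetSum _ fun i _ => integrable_finsetSum _ fun j _ =>
    (hv.hess K i j).integrable_sq]
  exact Finset.sum_congr rfl fun i _ => integral_finsetSum _ fun j _ =>
    (hv.hess K i j).integrable_sq

theorem normD_add_le (hκ : 0 < κ) (hα : 0 < α) {v w : T.Pair} (hv : v.Regular) (hw : w.Regular) :
    T.normD κ α (v + w) ≤ T.normD κ α v + T.normD κ α w := by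
  refine le_add_of_forall_weighted (Real.sqrt_nonneg _) (Real.sqrt_nonneg _) fun t ht => ?_
  rw [normD_sq hκ hα, normD_sq hκ hα, normD_sq hκ hα, Finset.mul_sum, Finset.mul_sum,
    ← Finset.sum_add_distrib]
  refine Finset.sum_le_sum fun K _ => ?_
  have hs := size_pos K
  have h1 : (v + w).gradSq K ≤ (1 + t) * v.gradSq K + (1 + 1 / t) * w.gradSq K := by
    rw [gradSq_eq (hv.add hw), gradSq_eq hv, gradSq_eq hw, Finset.mul_sum, Finset.mul_sum,
      ← Finset.sum_add_distrib]
    exact Finset.sum_le_sum fun i _ => integral_add_sq_le (hv.grad K i) (hw.grad K i) ht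
  have h2 : (v + w).jumpSq K ≤ (1 + t) * v.jumpSq K + (1 + 1 / t) * w.jumpSq K := by
    rw [Pair.jumpSq, Pair.jumpSq, Pair.jumpSq, Finset.mul_sum, Finset.mul_sum,
      ← Finset.sum_add_distrib]
    refine Finset.sum_le_sum fun F hF => ?_
    refine le_of_eq_of_le ?_ (integral_add_sq_le (hv.jump K F hF) (hw.jump K F hF) ht)
    congr 1
    funext x
    change ((v.bar F x + w.bar F x) - (v.tr K x + w.tr K x)) ^ 2 = ((v.bar F x - v.tr K x)
      + (w.bar F x - w.tr K x)) ^ 2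
    ring
  have h3 := mul_le_mul_of_nonneg_left h1 hκ.le
  have h4 := mul_le_mul_of_nonneg_left h2 (show 0 ≤ α * κ / size K.1 by positivity)
  linarith

/-! ### Trace and inverse inequalities for pairs -/

theorem dnSq_le {σ : ℝ} (hσ : 0 < σ) (hT : T.ShapeRegular σ) {v : T.Pair} (hv : v.Regular)
    (K : T.Cell) :
    size K.1 * v.dnSq K ≤ σ * (2 * (m + 1) * v.gradSq K + size K.1 ^ 2 * v.hessSq K) := by
  obtain ⟨x₀, hb⟩ := hT K.1 K.2
  have hs := size_pos K
  -- Since n is a unit vector, (∇v·n)² ≤ |∇v|²; the trace inequality with r = h/σ then applies to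
  -- each derivative separately.
  have h1 : v.dnSq K ≤ ∑ i, ∑ F ∈ T.facetsOf K, ∫ x, v.gradTr K i x ^ 2 ∂(surf F.1) := by
    rw [Finset.sum_comm]
    refine Finset.sum_le_sum fun F hF => ?_
    rw [← integral_finsetSum _ fun i _ => ((hv.trace K i).1 F hF).integrable_sq]
    refine integral_mono (hv.memLp_dn hF).integrable_sq
      (integrable_finsetSum _ fun i _ => ((hv.trace K i).1 F hF).integrable_sq) fun x => ?_
    refine (Finset.sum_mul_sq_le_sq_mul_sq _ _ _).trans (le_of_eq ?_)
    have h2 := (isOutwardNormal_normal hF).1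
    have h3 := EuclideanSpace.real_norm_sq_eq (normal K.1 F.1)
    rw [h2, one_pow] at h3
    rw [← h3, mul_one]
  have h2 := Finset.sum_le_sum fun i (_ : i ∈ Finset.univ) =>
    (hv.trace K i).trace_inequality (hv.grad K i) (hv.hess K i) (by positivity) hb
  rw [← Finset.mul_sum, Finset.sum_add_distrib, ← Finset.mul_sum, ← Finset.mul_sum,
    ← gradSq_eq hv, ← hessSq_eq hv] at h2
  have h3 : size K.1 / σ * v.dnSq K ≤ 2 * (m + 1) * v.gradSq K + size K.1 ^ 2 * v.hessSq K :=
    (mul_le_mul_of_nonneg_left h1 (by positivity)).trans h2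
  have h4 := mul_le_mul_of_nonneg_left h3 hσ.le
  have h5 : σ * (size K.1 / σ * v.dnSq K) = size K.1 * v.dnSq K := by
    field_simp
  linarith

/-- The inverse inequality for finite element pairs. -/
theorem exists_hessSq_le (m k : ℕ) {σ : ℝ} (hσ : 0 < σ) :
    ∃ C : ℝ, 0 < C ∧ ∀ (Ω : Set (E (m + 1))) (T : Triangulation Ω), T.ShapeRegular σ →
      ∀ (l : ℝ), ∀ v ∈ T.Wh k l, ∀ K : T.Cell,
        size K.1 ^ 2 * v.hessSq K ≤ C * v.gradSq K := by
  obtain ⟨C, hC, h⟩ := exists_inverse_inequality (d := m + 1) k hσ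
  refine ⟨(m + 1) * C, by positivity, fun Ω T hT l v hv K => ?_⟩
  have hr := regular_of_mem_Wh hv
  obtain ⟨p, q, hp, -, -, -, rfl⟩ := hv
  obtain ⟨x₀, hb⟩ := hT K.1 K.2
  have hs := size_pos K
  have hx₀ : x₀ ∈ hull K.1 := hb (Metric.mem_closedBall_self (by positivity))
  rw [hessSq_eq hr, gradSq_eq hr, Finset.mul_sum, Finset.mul_sum]
  refine Finset.sum_le_sum fun i _ => ?_
  rw [Finset.mul_sum]
  -- The inverse inequality is applied to ∂ᵢp, whose degree is again at most k; summing over the m +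
  -- 1 directions j gives the factor m + 1.
  refine (Finset.sum_le_sum fun j _ => h (hull K.1) x₀ (size K.1) (isCompact_hull _) hs hb
    (hull_subset_closedBall K hx₀) j (MvPolynomial.pderiv i (p K))
    ((totalDegree_pderiv_le i _).trans (hp K))).trans (le_of_eq ?_)
  rw [Finset.sum_const]
  simp
  ring_nf
  rfl

/-! ### The bilinear form -/

theorem BD_eq {v w : T.Pair} (hv : v.Regular) (hw : w.Regular) :
    T.BD κ α w v = ∑ K : T.Cell, (κ * (∑ i, ∫ x in hull K.1, w.grad K i x * v.grad K i x) +
      ∑ F ∈ T.facetsOf K, (κ * (∫ x, w.dn K F x * v.jump K F x ∂(surf F.1)) +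
        α * κ / size K.1 * (∫ x, w.jump K F x * v.jump K F x ∂(surf F.1)) +
        κ * ∫ x, w.jump K F x * v.dn K F x ∂(surf F.1))) := by
  rw [BD, ← Finset.sum_add_distrib, ← Finset.sum_add_distrib]
  refine Finset.sum_congr rfl fun K _ => ?_
  rw [add_assoc, ← Finset.sum_add_distrib]
  congr 1
  · rw [integral_const_mul, integral_finsetSum _ fun i _ =>
      integrable_mul_of_memLp (hw.grad K i) (hv.grad K i)]
  · refine Finset.sum_congr rfl fun F hF => ?_
    have i1 := integrable_mul_of_memLp (hw.memLp_dn hF) (hv.jump K F hF)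
    have i2 := integrable_mul_of_memLp (hw.jump K F hF) (hv.jump K F hF)
    have e : ∀ x, (κ * w.dn K F x + α * κ / size K.1 * w.jump K F x) * v.jump K F x
        = κ * (w.dn K F x * v.jump K F x) + α * κ / size K.1 * (w.jump K F x * v.jump K F x) :=
      fun x => by ring
    simp only [e, mul_assoc κ]
    rw [integral_add (i1.const_mul κ) (i2.const_mul _), integral_const_mul, integral_const_mul,
      integral_const_mul]

theorem BD_sub_left {v w w' : T.Pair} (hv : v.Regular) (hw : w.Regular) (hw' : w'.Regular) :
    T.BD κ α (w - w') v = T.BD κ α w v - T.BD κ α w' v := by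
  rw [BD_eq hv (hw.sub hw'), BD_eq hv hw, BD_eq hv hw', ← Finset.sum_sub_distrib]
  refine Finset.sum_congr rfl fun K _ => ?_
  have key : ∀ {X : Type} [MeasurableSpace X] {μ : Measure X} {f f' h g : X → ℝ},
      MemLp f 2 μ → MemLp f' 2 μ → MemLp g 2 μ → (∀ x, h x = f x - f' x) →
      ∫ x, h x * g x ∂μ = (∫ x, f x * g x ∂μ) - ∫ x, f' x * g x ∂μ := by
    intro X _ μ f f' h g hf hf' hg hh
    rw [← integral_sub (integrable_mul_of_memLp hf hg) (integrable_mul_of_memLp hf' hg)]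
    simp only [hh, sub_mul]
  have hj : ∀ F x, (w - w').jump K F x = w.jump K F x - w'.jump K F x := by
    intro F x
    change (w.bar F x - w'.bar F x) - (w.tr K x - w'.tr K x) = (w.bar F x - w.tr K x)
      - (w'.bar F x - w'.tr K x)
    ring
  have hd : ∀ F x, (w - w').dn K F x = w.dn K F x - w'.dn K F x := by
    intro F x
    change ∑ i, (w.gradTr K i x - w'.gradTr K i x) * normal K.1 F.1 i = _
    simp only [sub_mul, Finset.sum_sub_distrib]
    rfl
  have e1 : ∑ i, ∫ x in hull K.1, (w - w').grad K i x * v.grad K i x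
      = (∑ i, ∫ x in hull K.1, w.grad K i x * v.grad K i x)
        - ∑ i, ∫ x in hull K.1, w'.grad K i x * v.grad K i x := by
    rw [← Finset.sum_sub_distrib]
    exact Finset.sum_congr rfl fun i _ => key (hw.grad K i) (hw'.grad K i) (hv.grad K i)
      fun x => rfl
  rw [e1, mul_sub, add_sub_add_comm, ← Finset.sum_sub_distrib]
  congr 1
  refine Finset.sum_congr rfl fun F hF => ?_
  rw [key (hw.memLp_dn hF) (hw'.memLp_dn hF) (hv.jump K F hF) (hd F),
    key (hw.jump K F hF) (hw'.jump K F hF) (hv.jump K F hF) (hj F),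
    key (hw.jump K F hF) (hw'.jump K F hF) (hv.memLp_dn hF) (hj F)]
  ring

/-- Continuity of the bilinear form. -/
theorem abs_BD_le {σ : ℝ} (hσ : 0 < σ) (hT : T.ShapeRegular σ) (hκ : 0 < κ) (hα : 0 < α)
    {v w : T.Pair} (hw : w.Regular) (hv : v.Regular) :
    |T.BD κ α w v| ≤ (2 + σ * (2 * (m + 1) / α + 1)) * T.normD' κ α w * T.normD' κ α v := by
  set M := σ * (2 * (m + 1) / α + 1) with hM
  have hM0 : 0 < M := by positivity
  -- M is the sum of the gradient coefficient 2σ(m + 1)/α and the Hessian coefficient σ. A single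
  -- constant thus serves both terms of the primed norm.
  have hdn : ∀ {u : T.Pair}, u.Regular → ∀ K : T.Cell, κ * size K.1 / α * u.dnSq K
      ≤ M * (κ * u.gradSq K + size K.1 ^ 2 * κ / α * u.hessSq K) := by
    intro u hu K
    have hs := size_pos K
    have h1 := mul_le_mul_of_nonneg_left (dnSq_le hσ hT hu K) (show 0 ≤ κ / α by positivity)
    have h2 := gradSq_nonneg u K
    have h3 := hessSq_nonneg u K
    have e1 : M * (κ * u.gradSq K + size K.1 ^ 2 * κ / α * u.hessSq K)
        = κ / α * (σ * (2 * (m + 1) * u.gradSq K + size K.1 ^ 2 * u.hessSq K))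
          + (σ * κ * u.gradSq K
            + σ * (2 * (m + 1) / α) * (size K.1 ^ 2 * κ / α * u.hessSq K)) := by
      rw [hM]
      field_simp
      ring
    have e2 : κ * size K.1 / α * u.dnSq K = κ / α * (size K.1 * u.dnSq K) := by ring
    rw [e1, e2]
    have h4 : 0 ≤ σ * κ * u.gradSq K
            + σ * (2 * (m + 1) / α) * (size K.1 ^ 2 * κ / α * u.hessSq K) := by positivity
    linarith
  have hmain : |T.BD κ α w v| / (2 + M) ≤ T.normD' κ α w * T.normD' κ α v := by
    refine le_mul_of_forall_weighted (Real.sqrt_nonneg _) (Real.sqrt_nonneg _) fun t ht => ?_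
    rw [div_le_iff₀ (by positivity), BD_eq hv hw, normD'_sq hκ hα, normD'_sq hκ hα,
      normD_sq hκ hα, normD_sq hκ hα, ← Finset.sum_add_distrib, ← Finset.sum_add_distrib,
      Finset.mul_sum, Finset.mul_sum, ← Finset.sum_add_distrib, Finset.sum_mul]
    refine (Finset.abs_sum_le_sum_abs _ _).trans (Finset.sum_le_sum fun K _ => ?_)
    have hs := size_pos K
    have b1 : |κ * ∑ i, ∫ x in hull K.1, w.grad K i x * v.grad K i x|
        ≤ t / 2 * (κ * w.gradSq K) + 1 / (2 * t) * (κ * v.gradSq K) := by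
      rw [abs_mul, abs_of_pos hκ, gradSq_eq hw, gradSq_eq hv]
      have := (Finset.abs_sum_le_sum_abs (fun i => ∫ x in hull K.1, w.grad K i x * v.grad K i x)
        Finset.univ).trans (Finset.sum_le_sum fun i _ =>
          abs_integral_mul_le (hw.grad K i) (hv.grad K i) ht)
      rw [Finset.sum_add_distrib, ← Finset.mul_sum, ← Finset.mul_sum] at this
      have := mul_le_mul_of_nonneg_left this hκ.le
      linarith
    have b2 : |∑ F ∈ T.facetsOf K, (κ * (∫ x, w.dn K F x * v.jump K F x ∂(surf F.1)) +
        α * κ / size K.1 * (∫ x, w.jump K F x * v.jump K F x ∂(surf F.1)) +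
        κ * ∫ x, w.jump K F x * v.dn K F x ∂(surf F.1))|
        ≤ t / 2 * (κ * size K.1 / α * w.dnSq K + 2 * (α * κ / size K.1 * w.jumpSq K))
          + 1 / (2 * t) * (κ * size K.1 / α * v.dnSq K + 2 * (α * κ / size K.1 * v.jumpSq K)) := by
      have e : t / 2 * (κ * size K.1 / α * w.dnSq K + 2 * (α * κ / size K.1 * w.jumpSq K))
          + 1 / (2 * t) * (κ * size K.1 / α * v.dnSq K + 2 * (α * κ / size K.1 * v.jumpSq K))
          = ∑ F ∈ T.facetsOf K, (t / 2 * (κ * size K.1 / α * (∫ x, w.dn K F x ^ 2 ∂(surf F.1))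
            + 2 * (α * κ / size K.1 * ∫ x, w.jump K F x ^ 2 ∂(surf F.1)))
          + 1 / (2 * t) * (κ * size K.1 / α * (∫ x, v.dn K F x ^ 2 ∂(surf F.1))
            + 2 * (α * κ / size K.1 * ∫ x, v.jump K F x ^ 2 ∂(surf F.1)))) := by
        simp only [Pair.dnSq, Pair.jumpSq, Finset.sum_add_distrib, ← Finset.mul_sum]
      rw [e]
      refine (Finset.abs_sum_le_sum_abs _ _).trans (Finset.sum_le_sum fun F hF => ?_)
      -- The weights h/α and α/h turn each mixed term into the scaled flux (κh/α) dn² and the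
      -- penalty (ακ/h) jump². The jumps of w and of v each occur twice, hence the 2 in 2 + M.
      have c1 := abs_integral_mul_le (hw.memLp_dn hF) (hv.jump K F hF)
        (show 0 < t * (size K.1 / α) by positivity)
      have c2 := abs_integral_mul_le (hw.jump K F hF) (hv.jump K F hF) ht
      have c3 := abs_integral_mul_le (hw.jump K F hF) (hv.memLp_dn hF)
        (show 0 < t * (α / size K.1) by positivity)
      have d1 := mul_le_mul_of_nonneg_left c1 hκ.le
      have d2 := mul_le_mul_of_nonneg_left c2 (show 0 ≤ α * κ / size K.1 by positivity)
      have d3 := mul_le_mul_of_nonneg_left c3 hκ.le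
      refine (abs_add_three _ _ _).trans ?_
      rw [abs_mul, abs_mul, abs_mul, abs_of_pos hκ,
        abs_of_pos (show 0 < α * κ / size K.1 by positivity)]
      refine (add_le_add (add_le_add d1 d2) d3).trans (le_of_eq ?_)
      field_simp
      ring
    refine (abs_add_le _ _).trans ((add_le_add b1 b2).trans ?_)
    have n1 := hdn hw K
    have n2 := hdn hv K
    have p1 : 0 ≤ κ * w.gradSq K := mul_nonneg hκ.le (gradSq_nonneg w K)
    have p2 : 0 ≤ κ * v.gradSq K := mul_nonneg hκ.le (gradSq_nonneg v K)
    have p3 : 0 ≤ α * κ / size K.1 * w.jumpSq K := mul_nonneg (by positivity) (jumpSq_nonneg w K)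
    have p4 : 0 ≤ α * κ / size K.1 * v.jumpSq K := mul_nonneg (by positivity) (jumpSq_nonneg v K)
    have p5 : 0 ≤ size K.1 ^ 2 * κ / α * w.hessSq K :=
      mul_nonneg (by positivity) (hessSq_nonneg w K)
    have p6 : 0 ≤ size K.1 ^ 2 * κ / α * v.hessSq K :=
      mul_nonneg (by positivity) (hessSq_nonneg v K)
    have r1 : κ * w.gradSq K + (κ * size K.1 / α * w.dnSq K
        + 2 * (α * κ / size K.1 * w.jumpSq K)) ≤ (2 + M) * (κ * w.gradSq K
        + α * κ / size K.1 * w.jumpSq K + size K.1 ^ 2 * κ / α * w.hessSq K) := by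
      nlinarith [mul_nonneg hM0.le p3]
    have r2 : κ * v.gradSq K + (κ * size K.1 / α * v.dnSq K
        + 2 * (α * κ / size K.1 * v.jumpSq K)) ≤ (2 + M) * (κ * v.gradSq K
        + α * κ / size K.1 * v.jumpSq K + size K.1 ^ 2 * κ / α * v.hessSq K) := by
      nlinarith [mul_nonneg hM0.le p4]
    have s1 := mul_le_mul_of_nonneg_left r1 (show 0 ≤ t / 2 by positivity)
    have s2 := mul_le_mul_of_nonneg_left r2 (show 0 ≤ 1 / (2 * t) by positivity)
    linarith
  rw [div_le_iff₀ (by positivity)] at hmain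
  linarith

/-- The two norms are equivalent on the finite element space. -/
theorem normD'_le {C : ℝ} (hC : 0 < C) (hκ : 0 < κ) (hα : 0 < α) {v : T.Pair}
    (h : ∀ K : T.Cell, size K.1 ^ 2 * v.hessSq K ≤ C * v.gradSq K) :
    T.normD' κ α v ≤ (1 + C * α⁻¹) * T.normD κ α v := by
  have h0 : 0 ≤ T.normD κ α v := Real.sqrt_nonneg _
  refine le_of_sq_le_sq ?_ (by positivity)
  have h1 : ∑ K : T.Cell, size K.1 ^ 2 * κ / α * v.hessSq K ≤ C * α⁻¹ * T.normD κ α v ^ 2 := by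
    rw [normD_sq hκ hα, Finset.mul_sum]
    refine Finset.sum_le_sum fun K _ => ?_
    have hs := size_pos K
    have h2 := mul_le_mul_of_nonneg_left (h K) (show 0 ≤ κ / α by positivity)
    have p3 : 0 ≤ C * α⁻¹ * (α * κ / size K.1 * v.jumpSq K) :=
      mul_nonneg (by positivity) (mul_nonneg (by positivity) (jumpSq_nonneg v K))
    have e1 : size K.1 ^ 2 * κ / α * v.hessSq K = κ / α * (size K.1 ^ 2 * v.hessSq K) := by ring
    have e2 : C * α⁻¹ * (κ * v.gradSq K) = κ / α * (C * v.gradSq K) := by ring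
    rw [mul_add, e1, e2]
    linarith
  rw [normD'_sq hκ hα, mul_pow]
  -- The squared primed norm is at most 1 + C/α times the squared norm, and 1 + C/α ≤ (1 + C/α)².
  have h2 : 0 ≤ C * α⁻¹ := by positivity
  nlinarith [mul_nonneg h2 (sq_nonneg (T.normD κ α v)),
    mul_nonneg (mul_nonneg h2 h2) (sq_nonneg (T.normD κ α v))]

/-- Coercivity of the bilinear form. -/
theorem half_normD_sq_le_BD {M : ℝ} (hM : 0 < M) (hκ : 0 < κ) (hα : 4 * M < α) {v : T.Pair}
    (hv : v.Regular) (h : ∀ K : T.Cell, size K.1 * v.dnSq K ≤ M * v.gradSq K) :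
    1 / 2 * T.normD κ α v ^ 2 ≤ T.BD κ α v v := by
  have hα0 : 0 < α := by linarith
  rw [normD_sq hκ hα0, BD_eq hv hv, Finset.mul_sum]
  refine Finset.sum_le_sum fun K _ => ?_
  have hs := size_pos K
  have e1 : ∑ i, ∫ x in hull K.1, v.grad K i x * v.grad K i x = v.gradSq K := by
    rw [gradSq_eq hv]
    simp only [sq]
  have e2 : -(κ * (size K.1 / (2 * M)) * v.dnSq K + κ * (2 * M / size K.1) * v.jumpSq K)
      + α * κ / size K.1 * v.jumpSq K
      ≤ ∑ F ∈ T.facetsOf K, (κ * (∫ x, v.dn K F x * v.jump K F x ∂(surf F.1)) +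
        α * κ / size K.1 * (∫ x, v.jump K F x * v.jump K F x ∂(surf F.1)) +
        κ * ∫ x, v.jump K F x * v.dn K F x ∂(surf F.1)) := by
    rw [Pair.dnSq, Pair.jumpSq, Finset.mul_sum, Finset.mul_sum, Finset.mul_sum,
      ← Finset.sum_add_distrib, ← Finset.sum_neg_distrib, ← Finset.sum_add_distrib]
    refine Finset.sum_le_sum fun F hF => ?_
    -- With weight h/(2M), the two equal cross terms cost half of the gradient term and (2Mκ/h)
    -- jump². The latter is at most half of the penalty because 4M < α.
    have c1 := neg_le_of_abs_le (abs_integral_mul_le (hv.memLp_dn hF) (hv.jump K F hF)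
        (show 0 < size K.1 / (2 * M) by positivity))
    have e3 : ∫ x, v.jump K F x * v.dn K F x ∂(surf F.1)
        = ∫ x, v.dn K F x * v.jump K F x ∂(surf F.1) := by
      simp only [mul_comm]
    have e4 : ∫ x, v.jump K F x * v.jump K F x ∂(surf F.1)
        = ∫ x, v.jump K F x ^ 2 ∂(surf F.1) := by
      simp only [sq]
    have d1 := mul_le_mul_of_nonneg_left c1 hκ.le
    have e5 : 1 / (2 * (size K.1 / (2 * M))) = 2 * M / size K.1 / 2 := by
      field_simp
    rw [e5] at d1
    rw [e3, e4]
    linarith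
  have h1 := mul_le_mul_of_nonneg_left (h K) (show 0 ≤ κ / (2 * M) by positivity)
  have e6 : κ / (2 * M) * (M * v.gradSq K) = κ * v.gradSq K / 2 := by
    field_simp
  have e7 : κ / (2 * M) * (size K.1 * v.dnSq K) = κ * (size K.1 / (2 * M)) * v.dnSq K := by ring
  rw [e6, e7] at h1
  have h2 : κ * (2 * M / size K.1) * v.jumpSq K ≤ 1 / 2 * (α * κ / size K.1 * v.jumpSq K) := by
    have h3 := mul_nonneg (show 0 ≤ κ / size K.1 by positivity) (jumpSq_nonneg v K)
    have h4 := mul_le_mul_of_nonneg_right hα.le h3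
    have e8 : κ * (2 * M / size K.1) * v.jumpSq K = 1 / 2 * (4 * M * (κ / size K.1 * v.jumpSq K)) :=
      by ring
    have e9 : α * κ / size K.1 * v.jumpSq K = α * (κ / size K.1 * v.jumpSq K) := by ring
    rw [e8, e9]
    linarith
  rw [e1]
  linarith

/-! ### The finite element space is closed under differences -/

theorem ev_sub {d : ℕ} (p q : MvPolynomial (Fin d) ℝ) (x : E d) : ev (p - q) x = ev p x - ev q x := by
  simp [ev]

theorem polyPair_sub (p p' : T.Cell → MvPolynomial (Fin (m + 1)) ℝ)
    (q q' : T.Facet → MvPolynomial (Fin (m + 1)) ℝ) :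
    T.polyPair p q - T.polyPair p' q' = T.polyPair (fun K => p K - p' K) (fun F => q F - q' F) := by
  change Pair.mk _ _ _ _ _ _ = Pair.mk _ _ _ _ _ _
  congr <;> funext <;> simp [polyPair, ev]

/-- Pointwise (s - t)² ≤ 2s² + 2t². Additivity of the lower integral needs measurability of one
summand only, here the one built from a and a'. -/
theorem lintegral_sq_sub_div_lt_top {X : Type*} [MeasurableSpace X] {μ ν : Measure X} [SFinite ν]
    {a b a' b' : X → ℝ} (ha : Measurable a) (ha' : Measurable a') {D : X → X → ℝ}
    (hD : Measurable (Function.uncurry D)) (hD0 : ∀ x y, 0 ≤ D x y)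
    (h : ∫⁻ x, ∫⁻ y, ENNReal.ofReal ((a x - a' y) ^ 2 / D x y) ∂ν ∂μ < ⊤)
    (h' : ∫⁻ x, ∫⁻ y, ENNReal.ofReal ((b x - b' y) ^ 2 / D x y) ∂ν ∂μ < ⊤) :
    ∫⁻ x, ∫⁻ y, ENNReal.ofReal (((a x - b x) - (a' y - b' y)) ^ 2 / D x y) ∂ν ∂μ < ⊤ := by
  have hm : Measurable (fun z : X × X => ENNReal.ofReal ((a z.1 - a' z.2) ^ 2 / D z.1 z.2)) :=
    ((((ha.comp measurable_fst).sub (ha'.comp measurable_snd)).pow_const 2).div hD).ennreal_ofReal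
  have hmx : ∀ x, Measurable (fun y => ENNReal.ofReal ((a x - a' y) ^ 2 / D x y)) := fun x =>
    (((measurable_const.sub ha').pow_const 2).div hD.of_uncurry_left).ennreal_ofReal
  have hle : ∀ x y, ENNReal.ofReal (((a x - b x) - (a' y - b' y)) ^ 2 / D x y)
      ≤ 2 * (ENNReal.ofReal ((a x - a' y) ^ 2 / D x y)
        + ENNReal.ofReal ((b x - b' y) ^ 2 / D x y)) := by
    intro x y
    have hxy := hD0 x y
    rw [← ENNReal.ofReal_add (by positivity) (by positivity), ← ENNReal.ofReal_ofNat 2,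
      ← ENNReal.ofReal_mul zero_le_two]
    apply ENNReal.ofReal_le_ofReal
    rw [← add_div, ← mul_div_assoc]
    apply div_le_div_of_nonneg_right _ hxy
    nlinarith [sq_nonneg ((a x - a' y) + (b x - b' y))]
  calc ∫⁻ x, ∫⁻ y, ENNReal.ofReal (((a x - b x) - (a' y - b' y)) ^ 2 / D x y) ∂ν ∂μ
      ≤ ∫⁻ x, ∫⁻ y, 2 * (ENNReal.ofReal ((a x - a' y) ^ 2 / D x y)
        + ENNReal.ofReal ((b x - b' y) ^ 2 / D x y)) ∂ν ∂μ :=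
        lintegral_mono fun x => lintegral_mono fun y => hle x y
    _ = 2 * ((∫⁻ x, ∫⁻ y, ENNReal.ofReal ((a x - a' y) ^ 2 / D x y) ∂ν ∂μ)
        + ∫⁻ x, ∫⁻ y, ENNReal.ofReal ((b x - b' y) ^ 2 / D x y) ∂ν ∂μ) := by
        rw [← lintegral_add_left hm.lintegral_prod_right', ← lintegral_const_mul' 2 _ (by simp)]
        refine lintegral_congr fun x => ?_
        rw [lintegral_const_mul' 2 _ (by simp), lintegral_add_left (hmx x)]
    _ < ⊤ := ENNReal.mul_lt_top ENNReal.ofNat_lt_top (ENNReal.add_lt_top.2 ⟨h, h'⟩)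

theorem continuous_gradient {d : ℕ} {φ : E d → ℝ} (h : ContDiff ℝ ∞ φ) :
    Continuous (gradient φ) :=
  (InnerProductSpace.toDual ℝ (E d)).symm.continuous.comp (h.continuous_fderiv (by simp))

theorem gradient_sub {d : ℕ} {φ ψ : E d → ℝ} (hφ : ContDiff ℝ ∞ φ) (hψ : ContDiff ℝ ∞ ψ) (x : E d) :
    gradient (fun x => φ x - ψ x) x = gradient φ x - gradient ψ x := by
  simp only [gradient]
  rw [fderiv_fun_sub (hφ.differentiable (by simp) x) (hψ.differentiable (by simp) x), map_sub]

theorem MemHFacets.sub {l : ℝ} {q q' : T.Facet → MvPolynomial (Fin (m + 1)) ℝ}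
    (h : T.MemHFacets l fun F => ev (q F)) (h' : T.MemHFacets l fun F => ev (q' F)) :
    T.MemHFacets l fun F => ev (q F - q' F) := by
  simp only [MemHFacets, ev_sub]
  refine ⟨fun F => memLp_surf_of_continuous (continuous_ev _) F, fun h0 h1 F F' => ?_,
    fun h1 => ?_⟩
  · have := isFiniteMeasure_surf F'
    have hD : Measurable (Function.uncurry fun x y : E (m + 1) =>
        dist x y ^ (2 * l + (((m + 1 : ℕ) : ℝ) - 1))) := measurable_dist.pow_const _
    exact lintegral_sq_sub_div_lt_top (continuous_ev _).measurable (continuous_ev _).measurable hD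
      (fun x y => Real.rpow_nonneg dist_nonneg _) (h.2.1 h0 h1 F F') (h'.2.1 h0 h1 F F')
  · obtain ⟨φ, τ, hφ, hτ, hl⟩ := h.2.2 h1
    obtain ⟨φ', τ', hφ', hτ', hl'⟩ := h'.2.2 h1
    refine ⟨fun n x => φ n x - φ' n x, fun F x => τ F x - τ' F x, fun n => (hφ n).sub (hφ' n),
      fun F => (hτ F).sub (hτ' F), fun F => ⟨?_, ?_⟩⟩
    · have := tendsto_eLpNorm_sub_add (g := fun x => -ev (q' F) x) (γ := fun n x => -φ' n x)
        (fun n => ((hφ n).continuous.sub (continuous_ev (q F))).aestronglyMeasurable)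
        (fun n => (((hφ' n).continuous.neg).sub (continuous_ev (q' F)).neg).aestronglyMeasurable)
        (hl F).1 (tendsto_eLpNorm_sub_neg (hl' F).1)
      simpa only [← sub_eq_add_neg] using this
    · simp only [gradient_sub (hφ _) (hφ' _), map_sub]
      set P := (vectorSpan ℝ (F.1 : Set (E (m + 1)))).starProjection
      have hc := fun n => (P.continuous.comp
        (continuous_gradient (hφ n))).aestronglyMeasurable (μ := surf F.1)
      have hc' := fun n => (P.continuous.comp
        (continuous_gradient (hφ' n))).aestronglyMeasurable (μ := surf F.1)
      have := tendsto_eLpNorm_sub_add (g := fun x => -τ' F x)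
        (φ := fun n x => P (gradient (φ n) x))
        (γ := fun n x => -P (gradient (φ' n) x))
        (fun n => (hc n).sub (hτ F).aestronglyMeasurable)
        (fun n => (hc' n).neg.sub (hτ' F).aestronglyMeasurable.neg)
        (hl F).2 (tendsto_eLpNorm_sub_neg (hl' F).2)
      simpa only [← sub_eq_add_neg] using this

theorem sub_mem_Wh {k : ℕ} {l : ℝ} {v w : T.Pair} (hv : v ∈ T.Wh k l) (hw : w ∈ T.Wh k l) :
    v - w ∈ T.Wh k l := by
  obtain ⟨p, q, hp, hq, hH, h0, rfl⟩ := hv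
  obtain ⟨p', q', hp', hq', hH', h0', rfl⟩ := hw
  refine ⟨fun K => p K - p' K, fun F => q F - q' F,
    fun K => (MvPolynomial.totalDegree_sub _ _).trans (max_le (hp K) (hp' K)),
    fun F => (MvPolynomial.totalDegree_sub _ _).trans (max_le (hq F) (hq' F)),
    hH.sub hH', fun F hF x hx => ?_, polyPair_sub _ _ _ _⟩
  rw [ev_sub, h0 F hF x hx, h0' F hF x hx, sub_zero]

/-! ### Consistency and the error estimate -/

/-- The exact solution satisfies the discrete equations. -/
theorem BD_sobolevPair_eq (hΩ : IsDomain Ω) {k : ℕ} {l κ α : ℝ} {f : E (m + 1) → ℝ} {u : T.H2H10}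
    (hu : T.Solves κ f u) {v : T.Pair} (hv : v ∈ T.Wh k l) :
    T.BD κ α (T.sobolevPair u u) v = T.L f v := by
  have hvr := regular_of_mem_Wh hv
  have hur := regular_sobolevPair hΩ u u
  obtain ⟨p, q, -, -, -, h0, rfl⟩ := hv
  have hjump : ∀ K F x, (T.sobolevPair u u).jump K F x = 0 := fun K F x => sub_self _
  -- Green's formula turns the volume term into the load plus a boundary term with v; the flux
  -- against v̄ - v cancels it and leaves v̄ alone.
  have hcell : ∀ K : T.Cell,
      κ * (∑ i, ∫ x in hull K.1, u.grad i x * ev (MvPolynomial.pderiv i (p K)) x)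
        + ∑ F ∈ T.facetsOf K, κ * (∫ x, (T.sobolevPair u u).dn K F x *
          (T.polyPair p q).jump K F x ∂(surf F.1))
      = (∫ x in hull K.1, f x * ev (p K) x) + κ * ∑ i, ∑ F ∈ T.facetsOf K, normal K.1 F.1 i *
          ∫ x, u.gradTrace i x * ev (q F) x ∂(surf F.1) := by
    intro K
    have hL : ∫ x in hull K.1, f x * ev (p K) x
        = -κ * ∑ i, ∫ x in hull K.1, u.hess i i x * ev (p K) x := by
      have i0 : ∀ i, Integrable (fun x => u.hess i i x * ev (p K) x)
          (volume.restrict (hull K.1)) := fun i => integrable_mul_of_memLp (hur.hess K i i)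
        (memLp_hull_of_continuous (continuous_ev (p K)) K)
      rw [← integral_finsetSum _ fun i _ => i0 i, ← integral_const_mul]
      refine integral_congr_ae ?_
      have h1 : ∀ᵐ x ∂(volume.restrict (hull K.1)), - κ * ∑ i, u.hess i i x = f x :=
        ae_mono (Measure.restrict_mono_ae (hull_ae_le hΩ K)) hu
      filter_upwards [h1] with x hx
      rw [← hx, mul_assoc, Finset.sum_mul]
    have hG : ∀ i, (∫ x in hull K.1, u.hess i i x * ev (p K) x)
        + ∫ x in hull K.1, u.grad i x * ev (MvPolynomial.pderiv i (p K)) x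
        = ∑ F ∈ T.facetsOf K, normal K.1 F.1 i * ∫ x, u.gradTrace i x * ev (p K) x ∂(surf F.1) := by
      intro i
      have := (hur.trace K i).green (hur.grad K i) (hur.hess K i) (contDiff_ev (p K)) i
      simp only [pd_ev] at this
      exact this
    have hF : ∀ F ∈ T.facetsOf K, ∫ x, (T.sobolevPair u u).dn K F x *
          (T.polyPair p q).jump K F x ∂(surf F.1)
        = (∑ i, normal K.1 F.1 i * ∫ x, u.gradTrace i x * ev (q F) x ∂(surf F.1))
          - ∑ i, normal K.1 F.1 i * ∫ x, u.gradTrace i x * ev (p K) x ∂(surf F.1) := by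
      intro F hF
      have i1 : ∀ (r : MvPolynomial (Fin (m + 1)) ℝ) i,
          Integrable (fun x => u.gradTrace i x * ev r x) (surf F.1) := fun r i =>
        integrable_mul_of_memLp ((hur.trace K i).1 F hF)
          (memLp_surf_of_continuous (continuous_ev r) F)
      simp only [← integral_const_mul]
      rw [← integral_finsetSum _ fun i _ => (i1 (q F) i).const_mul _,
        ← integral_finsetSum _ fun i _ => (i1 (p K) i).const_mul _,
        ← integral_sub (integrable_finsetSum _ fun i _ => (i1 (q F) i).const_mul _)
          (integrable_finsetSum _ fun i _ => (i1 (p K) i).const_mul _)]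
      congr 1
      funext x
      change (∑ i, u.gradTrace i x * normal K.1 F.1 i) * (ev (q F) x - ev (p K) x) = _
      rw [← Finset.sum_sub_distrib, Finset.sum_mul]
      exact Finset.sum_congr rfl fun i _ => by ring
    rw [hL, ← Finset.mul_sum, Finset.sum_congr rfl hF, Finset.sum_sub_distrib,
      Finset.sum_comm (s := T.facetsOf K), Finset.sum_comm (s := T.facetsOf K),
      ← Finset.sum_congr rfl fun i _ => hG i, Finset.sum_add_distrib]
    ring
  rw [BD_eq hvr hur]
  simp only [hjump, zero_mul, integral_zero, mul_zero, add_zero]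
  refine (Finset.sum_congr rfl fun K _ => hcell K).trans ?_
  rw [Finset.sum_add_distrib, ← Finset.mul_sum, Finset.sum_comm]
  rw [Finset.sum_eq_zero (s := Finset.univ (α := Fin (m + 1))), mul_zero, add_zero]
  · rfl
  · intro i _
    -- The trace of ∂ᵢu is shared by neighbouring cells, so the integral against v̄ depends on the
    -- facet only; on boundary facets v̄ = 0.
    refine sum_normal_mul_eq_zero hΩ i (fun F => ∫ x, u.gradTrace i x * ev (q F) x ∂(surf F.1)) ?_
    intro F hF
    refine integral_eq_zero_of_ae ?_
    rw [surf]
    filter_upwards [ae_restrict_mem (isCompact_hull F.1).measurableSet] with x hx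
    simp [h0 F hF x hx]

theorem Pair.sub_add_sub_cancel (u v w : T.Pair) : (u - v) + (v - w) = u - w := by
  change Pair.mk _ _ _ _ _ _ = Pair.mk _ _ _ _ _ _
  congr <;> funext <;> apply _root_.sub_add_sub_cancel

/-- Quasi-optimality of a consistent, continuous and coercive method. -/
theorem normD_error_le (hΩ : IsDomain Ω) {k : ℕ} {l κ α β c C : ℝ} (hκ : 0 < κ) (hα : 0 < α)
    (hβ : 0 < β) (hc : 0 ≤ c) (hC : 0 ≤ C)
    (hnorm : ∀ v ∈ T.Wh k l, T.normD' κ α v ≤ c * T.normD κ α v)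
    (hcont : ∀ w v : T.Pair, w.Regular → v.Regular →
      |T.BD κ α w v| ≤ C * T.normD' κ α w * T.normD' κ α v)
    (hcoer : T.Coercive k l κ α β) {f : E (m + 1) → ℝ} {u : T.H2H10} {uh : T.Pair}
    (hu : T.Solves κ f u) (huh : T.SolvesFE k l κ α f uh) :
    T.normD κ α (T.sobolevPair u u - uh) ≤
      (1 + c * C / β) * ⨅ wh : T.Wh k l, T.normD' κ α (T.sobolevPair u u - wh) := by
  have : Nonempty (T.Wh k l) := ⟨⟨uh, huh.1⟩⟩
  -- With the nonnegative factor moved inside, it suffices to bound the error for each competitor w.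
  rw [Real.mul_iInf_of_nonneg (by positivity)]
  refine le_ciInf fun wh => ?_
  obtain ⟨w, hw⟩ := wh
  set U := T.sobolevPair u u
  have hU : U.Regular := regular_sobolevPair hΩ u u
  have hwr := regular_of_mem_Wh hw
  have huhr := regular_of_mem_Wh huh.1
  have hv : w - uh ∈ T.Wh k l := sub_mem_Wh hw huh.1
  have hvr := regular_of_mem_Wh hv
  set v := w - uh
  have hN0 : 0 ≤ T.normD κ α v := Real.sqrt_nonneg _
  have hE0 : 0 ≤ T.normD' κ α (U - w) := Real.sqrt_nonneg _
  have h1 : T.normD κ α (U - uh) ≤ T.normD κ α (U - w) + T.normD κ α v := by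
    have := normD_add_le hκ hα (hU.sub hwr) hvr
    rwa [Pair.sub_add_sub_cancel] at this
  -- Galerkin orthogonality: u and u_h satisfy the same discrete equations, so B(w - u_h, v) = B(w -
  -- u, v).
  have h2 : T.BD κ α v v = -T.BD κ α (U - w) v := by
    rw [BD_sub_left hvr hwr huhr, BD_sub_left hvr hU hwr, BD_sobolevPair_eq hΩ hu hv, huh.2 v hv]
    ring
  have h3 := hcoer v hv
  have h4 : T.BD κ α v v ≤ C * T.normD' κ α (U - w) * (c * T.normD κ α v) := by
    rw [h2]
    refine (neg_le_abs _).trans ((hcont _ _ (hU.sub hwr) hvr).trans ?_)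
    exact mul_le_mul_of_nonneg_left (hnorm v hv) (by positivity)
  have h5 : T.normD κ α v ≤ c * C / β * T.normD' κ α (U - w) := by
    -- Dividing by the norm of v requires it to be nonzero; otherwise the bound is trivial.
    rcases hN0.eq_or_lt with h | h
    · rw [← h]
      positivity
    · have h6 : (β * T.normD κ α v) * T.normD κ α v
          ≤ (c * C * T.normD' κ α (U - w)) * T.normD κ α v := by
        refine le_trans (le_of_eq ?_) (h3.trans (h4.trans (le_of_eq ?_))) <;> ring
      have h7 := le_of_mul_le_mul_right h6 h
      rw [div_mul_eq_mul_div, le_div_iff₀ hβ]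
      linarith
  have h8 := normD_le_normD' hκ hα (U - w)
  linarith

end Triangulation

end ISM

end

/-! ### The choice of constants and the four claims. -/

theorem mainTheorem6 (d k : ℕ) (hd : 1 ≤ d) (hd3 : d ≤ 3) (σ : ℝ) (hσ : 0 < σ) :
    ∃ c : ℝ, 0 < c ∧ ∃ (CD : ℝ → ℝ) (α₀ : ℝ) (β : ℝ → ℝ),
      (∀ α : ℝ, 0 < α → 0 < CD α) ∧ 0 < α₀ ∧ (∀ α : ℝ, α₀ < α → 0 < β α) ∧
      ∀ (Ω : Set (ISM.E d)) (_ : ISM.IsDomain Ω) (T : ISM.Triangulation Ω)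
        (_ : T.ShapeRegular σ) (l : ℝ) (_ : 0 ≤ l) (_ : l ≤ 1)
        (κ α : ℝ) (_ : 0 < κ) (_ : 0 < α),
        -- relation of the two norms on the finite element space
        (∀ v ∈ T.Wh k l, T.normD' κ α v ≤ (1 + c * α⁻¹) * T.normD κ α v) ∧
        -- continuity on the extended space
        (∀ w ∈ T.Wext k l, ∀ v ∈ T.Wext k l,
          |T.BD κ α w v| ≤ CD α * T.normD' κ α w * T.normD' κ α v) ∧
        -- coercivity for large penalty parameter
        (α₀ < α → T.Coercive k l κ α (β α)) ∧
        -- the error estimate, whenever the form is coercive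
        ∀ βD : ℝ, 0 < βD → T.Coercive k l κ α βD →
          ∀ (f : ISM.E d → ℝ) (u : T.H2H10) (uh : T.Pair),
            T.Solves κ f u → T.SolvesFE k l κ α f uh →
            T.normD κ α (T.sobolevPair u u - uh) ≤
              (1 + (1 + c * α⁻¹) * CD α / βD) *
                ⨅ wh : T.Wh k l, T.normD' κ α (T.sobolevPair u u - wh) := by

  obtain ⟨m, rfl⟩ : ∃ m, d = m + 1 := ⟨d - 1, by omega⟩
  obtain ⟨c, hc, hinv⟩ := ISM.Triangulation.exists_hessSq_le m k hσ
  -- Inserting the inverse inequality into the trace inequality gives h‖∇v·n‖² ≤ σ(2d + c)‖∇v‖² on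
  -- the discrete space. Hence the threshold is four times this constant and the coercivity constant
  -- is 1/2.
  have hM : 0 < σ * (2 * (m + 1) + c) := by positivity
  refine ⟨c, hc, fun α => 2 + σ * (2 * (m + 1) / α + 1), 4 * (σ * (2 * (m + 1) + c)),
    fun _ => 1 / 2, fun α hα => by positivity, by positivity, fun _ _ => by norm_num, ?_⟩
  intro Ω hΩ T hT l _ _ κ α hκ hα
  have hnorm : ∀ v ∈ T.Wh k l, T.normD' κ α v ≤ (1 + c * α⁻¹) * T.normD κ α v := fun v hv =>
    ISM.Triangulation.normD'_le hc hκ hα (hinv Ω T hT l v hv)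
  have hcont : ∀ w v : T.Pair, w.Regular → v.Regular → |T.BD κ α w v| ≤
      (2 + σ * (2 * (m + 1) / α + 1)) * T.normD' κ α w * T.normD' κ α v := fun w v hw hv =>
    ISM.Triangulation.abs_BD_le hσ hT hκ hα hw hv
  refine ⟨hnorm, fun w hw v hv => hcont w v (ISM.Triangulation.regular_of_mem_Wext hΩ hw)
    (ISM.Triangulation.regular_of_mem_Wext hΩ hv), fun hα₀ v hv => ?_, ?_⟩
  · refine ISM.Triangulation.half_normD_sq_le_BD hM hκ hα₀
      (ISM.Triangulation.regular_of_mem_Wh hv) fun K => ?_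
    have h1 := ISM.Triangulation.dnSq_le hσ hT (ISM.Triangulation.regular_of_mem_Wh hv) K
    have h2 := mul_le_mul_of_nonneg_left (hinv Ω T hT l v hv K) hσ.le
    linarith
  · intro βD hβD hcoer f u uh hu huh
    exact ISM.Triangulation.normD_error_le hΩ hκ hα hβD (by positivity) (by positivity) hnorm hcont
      hcoer hu huh
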